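/- **Setting.** Let $\nu$ be a probability measure on $\mathbb R$ with mean $0$ and variance $1$. For each $n$ let $J=(J_{jk})_{1\le j<k\le n}$ be i.i.d. with law $\nu$; write $\mathbb E_J,\mathbb P_J$ for expectation and probability over $J$. The Sherrington–Kirkpatrick cost function is $C(z)=n^{-1/2}\sum_{j<k}J_{jk}z_jz_k$ for $z\in\{\pm1\}^n$, also regarded as the diagonal operator $C|z\rangle=C(z)|z\rangle$ on $n$ qubits. Let $B=\sum_{j=1}^n X_j$ be the sum of the Pauli $X$ operators and $|s\rangle=2^{-n/2}\sum_z|z\rangle$. For $p\ge0$ and $\gamma,\beta\in\mathbb R^p$ the QAOA state is $$|\gamma,\beta\rangle=e^{-i\beta_pB}e^{-i\gamma_pC}\cdots e^{-i\beta_1B}e^{-i\gamma_1C}|s\rangle,$$ and $\langle O\rangle=\langle\gamma,\beta|O|\gamma,\beta\rangle$. **The limiting energy.** Let $A$ be the set of configurations $a=(a_1,\dots,a_p,a_{-p},\dots,a_{-1})\in\{\pm1\}^{2p}$, with bitwise product $ab$. Put $a^*_{r}=a_ra_{r+1}\cdots a_p$ and $a^*_{-r}=a_{-r}a_{-r-1}\cdots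 a_{-p}$ for $1\le r\le p$, $\Phi_a=\sum_{r=1}^p\gamma_r(a_r^*-a_{-r}^*)$, $\theta(b)=(1+b)/2$, and $$Q_a=\prod_{j=1}^p(\cos\beta_j)^{\theta(a_j)+\theta(a_{-j})}(\sin\beta_j)^{\theta(-a_j)+\theta(-a_{-j})}\,i^{\,\theta(-a_j)-\theta(-a_{-j})}.$$ Let $A_{p+1}=\{a: a_{-r}=a_r\ \forall r\}$. For $a\notin A_{p+1}$ let $r(a)$ be the largest $r$ with $a_{-r}=-a_r$, and let $\bar a$ be $a$ with the signs of $a_{r(a)}$ and $a_{-r(a)}$ flipped. Put $$F_b=\exp\Big[-\tfrac12\sum_{a\in A_{p+1}}Q_a\Phi_{ab}^2\Big],\qquad X_b=Q_bF_b,\qquad K_{b,c}=\tfrac12X_b\big(\Phi_{\bar bc}^2-\Phi_{bc}^2\big).$$ Let $D=\{b\in A\setminus A_{p+1}: b_1\cdots b_p=1\}$. Start with $R_j=1$ for all $j$, run through the elements $s$ of $D$ in an order in which $r(s)$ is non-decreasing, and at each of them replace $R_j$ by $R_j\exp(R_sK_{s,j})$ for all $j$. With the final values of $R$ let $Y_u=\exp[\sum_{j\in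 D}R_jK_{j,u}]$ and $W_u=X_uY_u$ for $u\in A$, and $$V_p(\gamma,\beta)=\frac i2\sum_{r=1}^p\gamma_r\Big[\sum_{u\in A}(u_r^*+u_{-r}^*)W_u\Big]\Big[\sum_{v\in A}(v_r^*-v_{-r}^*)W_v\Big].$$ **Claim.** For every $\nu$ as above, every fixed $p$ and all $\gamma,\beta\in\mathbb R^p$, the number $V_p=V_p(\gamma,\beta)$ is real, the expectations below exist, and the following hold. 1. As $n\to\infty$, $\mathbb E_J[\langle C/n\rangle]\to V_p$, and $$\lim_{n\to\infty}\mathbb E_J[\langle (C/n)^2\rangle]=V_p^2=\lim_{n\to\infty}\big(\mathbb E_J[\langle C/n\rangle]\big)^2 .$$ 2. (Concentration over instances, landscape independence.) $\mathbb E_J[\langle C/n\rangle^2]-(\mathbb E_J[\langle C/n\rangle])^2\to0$, and $\mathbb P_J(|\langle C/n\rangle-V_p|>\varepsilon)\to0$ for every $\varepsilon>0$. 3. (Concentration over measurements.) The measurement variance $\langle (C/n)^2\rangle-\langle C/n\rangle^2$ is nonnegative for every $J$; its expectation over $J$ tends to $0$, and it tends to $0$ in probability over $J$. Moreover, for all $\varepsilon,\delta>0$,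 with $\mathbb P_J$-probability tending to $1$ as $n\to\infty$ the instance $J$ has the following property: a string $z$ obtained by measuring $|\gamma,\beta\rangle$ in the computational basis satisfies $|C(z)/n-V_p|>\varepsilon$ with probability at most $\delta$. -/

import Mathlib

open MeasureTheory ProbabilityTheory Filter Topology
open scoped Matrix

namespace SKQAOA

noncomputable section

/-! ## The Sherrington-Kirkpatrick model -/

/-- Strings `z ∈ {+1,-1}^n`; the group `ℤˣ` is `{+1,-1}`. -/
abbrev Spins (n : ℕ) : Type := Fin n → ℤˣ

/-- A sign as a real number. -/
def sgn (s : ℤˣ) : ℝ := ((s : ℤ) : ℝ)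

/-- The pairs `j < k` that carry a coupling. -/
abbrev Pairs (n : ℕ) : Type := {e : Fin n × Fin n // e.1 < e.2}

/-- An instance: one real coupling `J_{jk}` for every `j < k`. -/
abbrev Couplings (n : ℕ) : Type := Pairs n → ℝ

/-- The law of an instance: the couplings are independent with common law `ν`. -/
def instanceLaw (ν : Measure ℝ) (n : ℕ) : Measure (Couplings n) :=
  Measure.pi fun _ : Pairs n => ν

/-- `C(z) = n^{-1/2} ∑_{j<k} J_{jk} z_j z_k`. -/
def cost {n : ℕ} (J : Couplings n) (z : Spins n) : ℝ :=
  (1 / Real.sqrt n) * ∑ e : Pairs n, J e * sgn (z e.1.1) * sgn (z e.1.2)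

/-! ## The quantum circuit on `n` qubits -/

/-- Operators on `n` qubits, as matrices in the computational basis. -/
abbrev Op (n : ℕ) : Type := Matrix (Spins n) (Spins n) ℂ

/-- The cost function as a diagonal operator. -/
def costOp {n : ℕ} (J : Couplings n) : Op n :=
  Matrix.diagonal fun z => (cost J z : ℂ)

/-- The Pauli operator `X_j`, which maps `|z⟩` to `|z⟩` with the `j`-th sign flipped. -/
def pauliX {n : ℕ} (j : Fin n) : Op n :=
  Matrix.of fun z' z => if z' = Function.update z j (-z j) then 1 else 0

/-- `B = ∑_j X_j`. -/
def mixer (n : ℕ) : Op n := ∑ j : Fin n, pauliX j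

/-- `U(C,γ) = e^{-iγC}`. -/
def costUnitary {n : ℕ} (J : Couplings n) (γ : ℝ) : Op n :=
  NormedSpace.exp ((-(Complex.I * (γ : ℂ))) • costOp J)

/-- `U(B,β) = e^{-iβB}`. -/
def mixerUnitary (n : ℕ) (β : ℝ) : Op n :=
  NormedSpace.exp ((-(Complex.I * (β : ℂ))) • mixer n)

/-- `|s⟩ = 2^{-n/2} ∑_z |z⟩`. -/
def uniformState (n : ℕ) : Spins n → ℂ := fun _ => ((1 / Real.sqrt (2 ^ n) : ℝ) : ℂ)

/-- `|γ,β⟩ = U(B,β_p) U(C,γ_p) ⋯ U(B,β_1) U(C,γ_1) |s⟩`; the layer with index `0 : Fin p`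
acts first. -/
def qaoaState {n p : ℕ} (J : Couplings n) (γ β : Fin p → ℝ) : Spins n → ℂ :=
  (List.finRange p).foldl
    (fun ψ r => mixerUnitary n (β r) *ᵥ (costUnitary J (γ r) *ᵥ ψ)) (uniformState n)

/-- `⟨ψ|O|ψ⟩`. -/
def braket {n : ℕ} (ψ : Spins n → ℂ) (O : Op n) : ℂ := star ψ ⬝ᵥ (O *ᵥ ψ)

/-- The operator `C/n`. -/
def energyOp {n : ℕ} (J : Couplings n) : Op n := ((n : ℂ)⁻¹) • costOp J

/-- `⟨γ,β|(C/n)^k|γ,β⟩`, a real number since `C` is Hermitian. -/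
def energyMoment {n p : ℕ} (k : ℕ) (γ β : Fin p → ℝ) (J : Couplings n) : ℝ :=
  (braket (qaoaState J γ β) (energyOp J ^ k)).re

/-- The probability that measuring `|γ,β⟩` in the computational basis returns a string
in `S`. -/
def measureProb {n p : ℕ} (γ β : Fin p → ℝ) (J : Couplings n) (S : Set (Spins n)) : ℝ :=
  ∑ z : Spins n, S.indicator (fun z => ‖qaoaState J γ β z‖ ^ 2) z

/-! ## The limiting energy `V_p(γ,β)` -/

/-- Configurations `(a_1,…,a_p,a_{-p},…,a_{-1})` of signs: the first component lists
`a_1,…,a_p` and the second one `a_{-1},…,a_{-p}`. Products of configurations are bitwise. -/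
abbrev Config (p : ℕ) : Type := (Fin p → ℤˣ) × (Fin p → ℤˣ)

variable {p : ℕ}

/-- `x*_r = x_r x_{r+1} ⋯ x_p`. -/
def starProd (x : Fin p → ℤˣ) (r : Fin p) : ℝ := sgn (∏ s ∈ Finset.Ici r, x s)

/-- `Φ_c = ∑_r γ_r (c*_r - c*_{-r})`. -/
def Phi (γ : Fin p → ℝ) (c : Config p) : ℝ :=
  ∑ r : Fin p, γ r * (starProd c.1 r - starProd c.2 r)

/-- `θ(b) = (1 + b) / 2`. -/
def theta (b : ℤˣ) : ℕ := if b = 1 then 1 else 0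

/-- `Q_a`. -/
def Q (β : Fin p → ℝ) (a : Config p) : ℂ :=
  ∏ j : Fin p,
    (Real.cos (β j) : ℂ) ^ (theta (a.1 j) + theta (a.2 j)) *
    (Real.sin (β j) : ℂ) ^ (theta (-a.1 j) + theta (-a.2 j)) *
    Complex.I ^ ((theta (-a.1 j) : ℤ) - (theta (-a.2 j) : ℤ))

/-- `r` is the largest index with `a_{-r} = -a_r`. With `r` running over `1,…,p`, this says
that `a` lies in the class `A_ℓ`, `ℓ = p - r + 1`. -/
def IsPivot (a : Config p) (r : Fin p) : Prop :=
  a.2 r = -a.1 r ∧ ∀ s : Fin p, r < s → a.2 s = a.1 s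

instance (a : Config p) (r : Fin p) : Decidable (IsPivot a r) := by
  unfold IsPivot; infer_instance

/-- The bar operation: flip both signs at the pivot. -/
def bar (a : Config p) : Config p :=
  (fun r => if IsPivot a r then -a.1 r else a.1 r,
   fun r => if IsPivot a r then -a.2 r else a.2 r)

/-- The class `A_{p+1}` of configurations with `a_{-r} = a_r` for all `r`. -/
def symmetricConfigs (p : ℕ) : Finset (Config p) :=
  Finset.univ.filter fun a => a.2 = a.1

/-- `F_b = exp(-½ ∑_{a ∈ A_{p+1}} Q_a Φ_{ab}²)`. -/
def F (γ β : Fin p → ℝ) (b : Config p) : ℂ :=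
  Complex.exp (-(1 / 2) * ∑ a ∈ symmetricConfigs p, Q β a * ((Phi γ (a * b) : ℝ) : ℂ) ^ 2)

/-- `X_b = Q_b F_b`. -/
def X (γ β : Fin p → ℝ) (b : Config p) : ℂ := Q β b * F γ β b

/-- `K_{b,c} = ½ X_b (Φ_{b̄c}² - Φ_{bc}²)`. -/
def K (γ β : Fin p → ℝ) (b c : Config p) : ℂ :=
  (1 / 2) * X γ β b * ((Phi γ (bar b * c) ^ 2 - Phi γ (b * c) ^ 2 : ℝ) : ℂ)

/-- The configurations in `D` with pivot `r`, where `D` consists of the configurations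
outside `A_{p+1}` with `a_1 a_2 ⋯ a_p = 1`, one from every pair `{b, b̄}`. -/
def DAt (r : Fin p) : Finset (Config p) :=
  Finset.univ.filter fun a => IsPivot a r ∧ ∏ s, a.1 s = 1

/-- `D` as a list in the order in which it is processed (from the last index `|D|` to the
first): by increasing pivot, that is, by decreasing class `A_ℓ`. -/
def DList (p : ℕ) : List (Config p) :=
  (List.finRange p).flatMap fun r => (DAt r).toList

/-- One step of the iteration: `R_j := R_j exp(R_s K_{s,j})` for all `j`. -/
def updateR (γ β : Fin p → ℝ) (R : Config p → ℂ) (s : Config p) : Config p → ℂ :=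
  fun j => R j * Complex.exp (R s * K γ β s j)

/-- The array `R` at the end of the iteration, started from the constant `1`. (The step for
the first element of `D`, processed last, multiplies by `exp 0` on `D` because that element
plays well with all elements of `D`, so it makes no difference whether it is carried out.) -/
def R (γ β : Fin p → ℝ) : Config p → ℂ :=
  (DList p).foldl (updateR γ β) fun _ => 1

/-- `Y_u = exp(∑_{j ∈ D} R_j K_{j,u})`. -/
def Y (γ β : Fin p → ℝ) (u : Config p) : ℂ :=
  Complex.exp (∑ r : Fin p, ∑ j ∈ DAt r, R γ β j * K γ β j u)

/-- `W_u = X_u Y_u`. -/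
def W (γ β : Fin p → ℝ) (u : Config p) : ℂ := X γ β u * Y γ β u

/-- The formula
`(i/2) ∑_r γ_r [∑_u (u*_r + u*_{-r}) W_u] [∑_v (v*_r - v*_{-r}) W_v]`. -/
def energyFormula (γ β : Fin p → ℝ) : ℂ :=
  (Complex.I / 2) * ∑ r : Fin p, (γ r : ℂ) *
    (∑ u : Config p, ((starProd u.1 r + starProd u.2 r : ℝ) : ℂ) * W γ β u) *
    (∑ v : Config p, ((starProd v.1 r - starProd v.2 r : ℝ) : ℂ) * W γ β v)

/-- `V_p(γ,β)`, as a real number. -/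
def V (γ β : Fin p → ℝ) : ℝ := (energyFormula γ β).re

end

end SKQAOA

/-!
Inserting the computational basis between the layers turns an averaged energy moment into a sum
over one history per qubit, consisting of its configuration of sign changes and its final sign.
Averaging over the couplings makes two histories interact only through the characteristic function
of `ν` at `phase / √n`, which is `1 - phase² / (2n) + o(1/n)` because `ν` is standardized, so the
average is a complex mean-field partition function into which every term of `C` inserts a factor
of order `i · phase / √n`. The moments are thereby reduced to the marginals of boundedly many
qubits.

The marginals converge to products of the numbers `W / 2`, by induction on the depth. By unitarity
the last layer can be summed out at every unpinned qubit which does not feel the field of the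
pinned ones. That field differs from `1` by `O(1/n)`, and expanding in the difference selects `k`
of the `n` sites, hence marginals of smaller depth with `k` further pinned sites, dominated by
`B ^ k / k!`. The limiting series sums to an exponential, which is the self-consistency equation
`w_u = Q_u exp(-½ ∑_a w_a Φ_{au}²)` with `w` odd under the bar operation. The equation is
triangular with respect to the pivot, and the iteration defining `R` solves it explicitly.

In the second moment the pairs of terms of `C` which share no site dominate, so its limit is the
square of that of the first moment, and the concentration statements follow from Chebyshev's
inequality.
-/

namespace SKQAOA

noncomputable section

/-! ## Configurations and the bar operation -/

section Configurations

variable {p : ℕ}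

lemma sgn_mul (s t : ℤˣ) : sgn (s * t) = sgn s * sgn t := by simp [sgn]

lemma sgn_neg (s : ℤˣ) : sgn (-s) = -sgn s := by simp [sgn]

@[simp] lemma sgn_one : sgn 1 = 1 := by simp [sgn]

@[simp] lemma sgn_sq (s : ℤˣ) : sgn s ^ 2 = 1 := by
  rw [sq, ← sgn_mul, Int.units_mul_self, sgn_one]

lemma starProd_mul (x y : Fin p → ℤˣ) (r : Fin p) :
    starProd (x * y) r = starProd x r * starProd y r := by
  simp [starProd, Finset.prod_mul_distrib, sgn_mul]

lemma starProd_mulSingle_neg_one (r q : Fin p) :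
    starProd (Pi.mulSingle r (-1)) q = if q ≤ r then -1 else 1 := by
  simp only [starProd, Pi.mulSingle_apply, Finset.prod_ite_eq', Finset.mem_Ici]
  split_ifs <;> simp [sgn]

lemma starProd_congr {x y : Fin p → ℤˣ} {r : Fin p} (h : ∀ s, r ≤ s → x s = y s) :
    starProd x r = starProd y r :=
  congrArg sgn (Finset.prod_congr rfl fun s hs => h s (Finset.mem_Ici.1 hs))

lemma Phi_mul_comm (γ : Fin p → ℝ) (a b : Config p) : Phi γ (a * b) = Phi γ (b * a) := by
  rw [mul_comm]

lemma Phi_eq_zero (γ : Fin p → ℝ) {a : Config p} (ha : a.2 = a.1) : Phi γ a = 0 := by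
  simp [Phi, ha]

/-- The configuration `a` is symmetric beyond `r`: one has `a_{-s} = a_s` for all `s > r`, which
is what `IsPivot a r` demands of the signs beyond `r`. -/
def IsSymmetricAbove (a : Config p) (r : Fin p) : Prop := ∀ s, r < s → a.2 s = a.1 s

lemma IsPivot.isSymmetricAbove {a : Config p} {r s : Fin p} (hr : IsPivot a r) (hrs : r ≤ s) :
    IsSymmetricAbove a s := fun t hst => hr.2 t (hrs.trans_lt hst)

lemma isSymmetricAbove_of_eq {a : Config p} (ha : a.2 = a.1) (r : Fin p) :
    IsSymmetricAbove a r := fun s _ => congrFun ha s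

lemma IsPivot.not_isSymmetricAbove {a : Config p} {r s : Fin p} (hr : IsPivot a r) (hsr : s < r) :
    ¬ IsSymmetricAbove a s := fun h => units_ne_neg_self (a.1 r) ((h r hsr).symm.trans hr.1)

lemma IsPivot.unique {a : Config p} {r s : Fin p} (hr : IsPivot a r) (hs : IsPivot a s) :
    r = s :=
  le_antisymm (not_lt.1 fun h => hr.not_isSymmetricAbove h hs.2)
    (not_lt.1 fun h => hs.not_isSymmetricAbove h hr.2)

lemma exists_isPivot_iff {a : Config p} : (∃ r, IsPivot a r) ↔ a.2 ≠ a.1 := by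
  constructor
  · rintro ⟨r, hr⟩ h
    exact units_ne_neg_self (a.1 r) ((congrFun h r).symm.trans hr.1)
  · intro h
    have hne : (Finset.univ.filter fun s => a.2 s ≠ a.1 s).Nonempty := by
      simpa [Finset.filter_nonempty_iff] using Function.ne_iff.1 h
    refine ⟨Finset.max' _ hne,
      Int.units_ne_iff_eq_neg.1 (Finset.mem_filter.1 (Finset.max'_mem _ hne)).2, fun s hs => ?_⟩
    by_contra hne'
    exact hs.not_ge (Finset.le_max' _ s (Finset.mem_filter.2 ⟨Finset.mem_univ s, hne'⟩))

lemma IsPivot.bar_eq {a : Config p} {r : Fin p} (hr : IsPivot a r) :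
    bar a = a * (Pi.mulSingle r (-1), Pi.mulSingle r (-1)) := by
  have h : ∀ s, IsPivot a s ↔ s = r := fun s => ⟨fun hs => hs.unique hr, fun hs => hs ▸ hr⟩
  ext s <;> simp only [bar, h, Prod.fst_mul, Prod.snd_mul, Pi.mul_apply, Pi.mulSingle_apply] <;>
    split_ifs <;> simp

lemma IsPivot.bar {a : Config p} {r : Fin p} (hr : IsPivot a r) : IsPivot (bar a) r := by
  rw [hr.bar_eq]
  refine ⟨by simp [hr.1], fun s hs => ?_⟩
  simp [hr.2 s hs]

lemma IsPivot.bar_bar {a : Config p} {r : Fin p} (hr : IsPivot a r) :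
    SKQAOA.bar (SKQAOA.bar a) = a := by
  have hflip : (Pi.mulSingle r (-1) : Fin p → ℤˣ) * Pi.mulSingle r (-1) = 1 := by
    simp [← Pi.mulSingle_mul]
  rw [hr.bar.bar_eq, hr.bar_eq, mul_assoc]
  simp [hflip]

lemma IsPivot.prod_bar_fst {a : Config p} {r : Fin p} (hr : IsPivot a r) :
    ∏ s, (SKQAOA.bar a).1 s = -∏ s, a.1 s := by
  rw [hr.bar_eq]
  simp only [Prod.fst_mul, Pi.mul_apply, Finset.prod_mul_distrib, Pi.mulSingle_apply,
    Finset.prod_ite_eq', Finset.mem_univ, if_true, mul_neg, mul_one]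

-- The terms of `Φ` with index at most `r` are odd under the flip, and the others vanish.
lemma Phi_bar_mul (γ : Fin p → ℝ) {a b : Config p} {r : Fin p} (hr : IsPivot a r)
    (hb : IsSymmetricAbove b r) : Phi γ (bar a * b) = -Phi γ (a * b) := by
  unfold Phi
  rw [← Finset.sum_neg_distrib]
  refine Finset.sum_congr rfl fun q _ => ?_
  rw [hr.bar_eq]
  simp only [Prod.fst_mul, Prod.snd_mul, starProd_mul, starProd_mulSingle_neg_one]
  split_ifs with hq
  · ring
  · have above : ∀ {c : Config p}, IsSymmetricAbove c r → starProd c.2 q = starProd c.1 q :=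
      fun hc => starProd_congr fun s hs => hc s ((not_le.1 hq).trans_le hs)
    rw [above hr.2, above hb]
    ring

lemma Phi_bar_mul_sq (γ : Fin p → ℝ) {a b : Config p} {r : Fin p} (hr : IsPivot a r)
    (hb : IsSymmetricAbove b r) : Phi γ (bar a * b) ^ 2 = Phi γ (a * b) ^ 2 := by
  rw [Phi_bar_mul γ hr hb, neg_sq]

lemma Phi_mul_bar_sq (γ : Fin p → ℝ) {a b : Config p} {r : Fin p} (hr : IsPivot a r)
    (hb : IsSymmetricAbove b r) : Phi γ (b * bar a) ^ 2 = Phi γ (b * a) ^ 2 := by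
  rw [mul_comm, Phi_bar_mul_sq γ hr hb, mul_comm]

/-- The factor of `Q` that belongs to one layer. -/
def mixFactor (β : ℝ) (x y : ℤˣ) : ℂ :=
  (Real.cos β : ℂ) ^ (theta x + theta y) * (Real.sin β : ℂ) ^ (theta (-x) + theta (-y)) *
    Complex.I ^ ((theta (-x) : ℤ) - (theta (-y) : ℤ))

lemma Q_eq_prod_mixFactor (β : Fin p → ℝ) (a : Config p) :
    Q β a = ∏ j, mixFactor (β j) (a.1 j) (a.2 j) := rfl

lemma theta_neg_one : theta (-1) = 0 := by decide

lemma theta_one : theta 1 = 1 := by decide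

lemma mixFactor_neg_self (β : ℝ) (x : ℤˣ) : mixFactor β (-x) x = -mixFactor β x (-x) := by
  rcases Int.units_eq_one_or x with rfl | rfl <;>
    simp [mixFactor, theta_one, theta_neg_one]

lemma mixFactor_self_add (β : ℝ) : mixFactor β 1 1 + mixFactor β (-1) (-1) = 1 := by
  simp only [mixFactor, theta_one, theta_neg_one, neg_neg, Nat.cast_one, Nat.cast_zero, sub_self,
    zpow_zero, add_zero, pow_zero, mul_one, one_mul]
  exact_mod_cast Real.cos_sq_add_sin_sq β

lemma Q_bar (β : Fin p → ℝ) {a : Config p} {r : Fin p} (hr : IsPivot a r) :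
    Q β (bar a) = -Q β a := by
  have hfactor : ∀ j, mixFactor (β j) ((bar a).1 j) ((bar a).2 j) =
      mixFactor (β j) (a.1 j) (a.2 j) * if j = r then -1 else 1 := by
    intro j
    rw [hr.bar_eq]
    simp only [Prod.fst_mul, Prod.snd_mul, Pi.mul_apply, Pi.mulSingle_apply]
    split_ifs with hj
    · subst hj
      simp [hr.1, mixFactor_neg_self]
    · simp
  rw [Q_eq_prod_mixFactor, Q_eq_prod_mixFactor, Finset.prod_congr rfl fun j _ => hfactor j,
    Finset.prod_mul_distrib]
  simp

lemma mem_symmetricConfigs {a : Config p} : a ∈ symmetricConfigs p ↔ a.2 = a.1 := by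
  simp [symmetricConfigs]

lemma mem_DAt {a : Config p} {r : Fin p} : a ∈ DAt r ↔ IsPivot a r ∧ ∏ s, a.1 s = 1 := by
  simp [DAt]

section SumConfig

variable {M : Type*} [AddCommMonoid M]

lemma sum_DAt_add_bar (r : Fin p) (H : Config p → M) :
    ∑ j ∈ DAt r, (H j + H (bar j)) = ∑ a with IsPivot a r, H a := by
  rw [Finset.sum_add_distrib, ← Finset.sum_filter_add_sum_filter_not
    (Finset.univ.filter fun a : Config p => IsPivot a r) (fun a => ∏ s, a.1 s = 1) H]
  congr 1
  · exact Finset.sum_congr (by ext; simp [mem_DAt]) fun _ _ => rfl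
  · refine Finset.sum_nbij' bar bar ?_ ?_ ?_ ?_ fun _ _ => rfl
    · intro a ha
      obtain ⟨hr, hprod⟩ := mem_DAt.1 ha
      simp only [Finset.mem_filter, Finset.mem_univ, true_and]
      exact ⟨hr.bar, by rw [hr.prod_bar_fst, hprod]; decide⟩
    · intro a ha
      simp only [Finset.mem_filter, Finset.mem_univ, true_and] at ha
      refine mem_DAt.2 ⟨ha.1.bar, ?_⟩
      rw [ha.1.prod_bar_fst, Int.units_ne_iff_eq_neg.1 ha.2, neg_neg]
    · exact fun a ha => (mem_DAt.1 ha).1.bar_bar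
    · exact fun a ha => (Finset.mem_filter.1 (Finset.mem_filter.1 ha).1).2.bar_bar

lemma sum_eq_sum_symmetricConfigs_add (H : Config p → M) :
    ∑ a, H a = ∑ a ∈ symmetricConfigs p, H a + ∑ r, ∑ j ∈ DAt r, (H j + H (bar j)) := by
  have hdisj : ((Finset.univ : Finset (Fin p)) : Set (Fin p)).PairwiseDisjoint
      fun r => Finset.univ.filter fun a : Config p => IsPivot a r :=
    fun r _ s _ hrs => Finset.disjoint_left.2 fun a har has =>
      hrs ((Finset.mem_filter.1 har).2.unique (Finset.mem_filter.1 has).2)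
  rw [← Finset.sum_filter_add_sum_filter_not Finset.univ (fun a : Config p => a.2 = a.1) H]
  simp only [sum_DAt_add_bar]
  rw [← Finset.sum_biUnion hdisj]
  congr 1
  refine Finset.sum_congr ?_ fun _ _ => rfl
  ext a
  simpa using exists_isPivot_iff.symm

end SumConfig

/-! ## The fixed point equation for `W` -/

lemma K_eq_zero (γ β : Fin p → ℝ) {b c : Config p} {r : Fin p} (hr : IsPivot b r)
    (hc : IsSymmetricAbove c r) : K γ β b c = 0 := by
  simp [K, Phi_bar_mul_sq γ hr hc]

lemma K_bar_right (γ β : Fin p → ℝ) {b c : Config p} {r s : Fin p} (hr : IsPivot b r)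
    (hs : IsPivot c s) : K γ β b (bar c) = K γ β b c := by
  rcases le_or_gt s r with h | h
  · rw [K_eq_zero γ β hr (hs.bar.isSymmetricAbove h), K_eq_zero γ β hr (hs.isSymmetricAbove h)]
  · rw [K, K, Phi_mul_bar_sq γ hs (hr.bar.isSymmetricAbove h.le),
      Phi_mul_bar_sq γ hs (hr.isSymmetricAbove h.le)]

/-- One step of the iteration that defines `R`, for an arbitrary kernel `κ`. -/
def expStep {α : Type*} (κ : α → α → ℂ) (f : α → ℂ) (s : α) : α → ℂ :=
  fun j => f j * Complex.exp (f s * κ s j)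

lemma updateR_eq_expStep (γ β : Fin p → ℝ) : updateR γ β = expStep (K γ β) := rfl

lemma foldl_expStep_eq_exp_sum {α : Type*} {κ : α → α → ℂ} {l : List α}
    (hκ : l.Pairwise fun s t => κ t s = 0) (hdiag : ∀ s ∈ l, κ s s = 0) (j : α) :
    l.foldl (expStep κ) (fun _ => 1) j =
      Complex.exp (l.map fun s => l.foldl (expStep κ) (fun _ => 1) s * κ s j).sum := by
  induction l using List.reverseRecOn generalizing j with
  | nil => simp
  | append_singleton l s ih =>
    obtain ⟨hl, -, hls⟩ := List.pairwise_append.1 hκ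
    have settled : ∀ t ∈ l, expStep κ (l.foldl (expStep κ) fun _ => 1) s t =
        l.foldl (expStep κ) (fun _ => 1) t := fun t ht => by
      simp [expStep, hls t ht s (List.mem_singleton_self s)]
    have settled_last : expStep κ (l.foldl (expStep κ) fun _ => 1) s s =
        l.foldl (expStep κ) (fun _ => 1) s := by
      simp [expStep, hdiag s (by simp)]
    simp only [List.foldl_append, List.foldl_cons, List.foldl_nil, List.map_append,
      List.sum_append, List.map_singleton, List.sum_singleton]
    rw [List.map_congr_left (g := fun t => l.foldl (expStep κ) (fun _ => 1) t * κ t j)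
      fun t ht => by rw [settled t ht], settled_last, Complex.exp_add,
      ← ih hl fun t ht => hdiag t (by simp [ht])]
    rfl

lemma pairwise_DList_K_eq_zero (γ β : Fin p → ℝ) :
    (DList p).Pairwise fun s t => K γ β t s = 0 := by
  rw [DList, List.pairwise_flatMap]
  constructor
  · refine fun r _ => List.pairwise_of_forall_mem_list fun a ha b hb => ?_
    rw [Finset.mem_toList, mem_DAt] at ha hb
    exact K_eq_zero γ β hb.1 ha.1.2
  · refine (List.pairwise_lt_finRange p).imp fun {r s} hrs a ha b hb => ?_
    rw [Finset.mem_toList, mem_DAt] at ha hb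
    exact K_eq_zero γ β hb.1 (ha.1.isSymmetricAbove hrs.le)

lemma sum_map_DList {M : Type*} [AddCommMonoid M] (G : Config p → M) :
    ((DList p).map G).sum = ∑ r, ∑ j ∈ DAt r, G j := by
  rw [DList, List.map_flatMap, List.flatMap_def, List.sum_flatten, List.map_map,
    ← List.ofFn_eq_map, List.sum_ofFn]
  simp

lemma R_eq_Y (γ β : Fin p → ℝ) : R γ β = Y γ β := by
  have hdiag : ∀ s ∈ DList p, K γ β s s = 0 := by
    intro s hs
    obtain ⟨r, -, hr⟩ := List.mem_flatMap.1 hs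
    rw [Finset.mem_toList, mem_DAt] at hr
    exact K_eq_zero γ β hr.1 hr.1.2
  funext j
  rw [Y, ← sum_map_DList, R, updateR_eq_expStep]
  exact foldl_expStep_eq_exp_sum (pairwise_DList_K_eq_zero γ β) hdiag j

lemma F_of_symmetric (γ β : Fin p → ℝ) {b : Config p} (hb : b.2 = b.1) : F γ β b = 1 := by
  rw [F, Finset.sum_eq_zero, mul_zero, Complex.exp_zero]
  intro a ha
  rw [mem_symmetricConfigs] at ha
  rw [Phi_eq_zero γ (a := a * b) (by rw [Prod.snd_mul, Prod.fst_mul, ha, hb])]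
  simp

lemma F_bar (γ β : Fin p → ℝ) {b : Config p} {r : Fin p} (hr : IsPivot b r) :
    F γ β (bar b) = F γ β b := by
  unfold F
  congr 2
  refine Finset.sum_congr rfl fun a ha => ?_
  rw [← Complex.ofReal_pow, ← Complex.ofReal_pow,
    Phi_mul_bar_sq γ hr (isSymmetricAbove_of_eq (mem_symmetricConfigs.1 ha) r)]

lemma Y_of_symmetric (γ β : Fin p → ℝ) {b : Config p} (hb : b.2 = b.1) : Y γ β b = 1 := by
  rw [Y, Finset.sum_eq_zero, Complex.exp_zero]
  refine fun r _ => Finset.sum_eq_zero fun j hj => ?_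
  rw [K_eq_zero γ β (mem_DAt.1 hj).1 (isSymmetricAbove_of_eq hb r), mul_zero]

lemma Y_bar (γ β : Fin p → ℝ) {b : Config p} {r : Fin p} (hr : IsPivot b r) :
    Y γ β (bar b) = Y γ β b := by
  unfold Y
  congr 1
  refine Finset.sum_congr rfl fun q _ => Finset.sum_congr rfl fun j hj => ?_
  rw [K_bar_right γ β (mem_DAt.1 hj).1 hr]

lemma W_of_symmetric (γ β : Fin p → ℝ) {b : Config p} (hb : b.2 = b.1) : W γ β b = Q β b := by
  simp [W, X, F_of_symmetric γ β hb, Y_of_symmetric γ β hb]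

lemma W_bar (γ β : Fin p → ℝ) {b : Config p} {r : Fin p} (hr : IsPivot b r) :
    W γ β (bar b) = -W γ β b := by
  simp [W, X, F_bar γ β hr, Y_bar γ β hr, Q_bar β hr]

/-- The quadratic field `∑_a w_a Φ_{au}²` that weights `w` on configurations exert on `u`. -/
def quadraticField (γ : Fin p → ℝ) (w : Config p → ℂ) (u : Config p) : ℂ :=
  ∑ a, w a * (Phi γ (a * u) : ℂ) ^ 2

/-- Weights that are odd under the bar operation and solve the self-consistency equation
`w_u = Q_u exp(-½ ∑_a w_a Φ_{au}²)` of the infinite system. -/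
structure IsMeanField (γ β : Fin p → ℝ) (w : Config p → ℂ) : Prop where
  map_bar : ∀ {a r}, IsPivot a r → w (bar a) = -w a
  eq_Q_mul_exp : ∀ u, w u = Q β u * Complex.exp (-(1 / 2) * quadraticField γ w u)

lemma neg_half_mul_quadraticField_W (γ β : Fin p → ℝ) (u : Config p) :
    -(1 / 2) * quadraticField γ (W γ β) u =
      -(1 / 2) * ∑ a ∈ symmetricConfigs p, Q β a * (Phi γ (a * u) : ℂ) ^ 2 +
        ∑ r, ∑ j ∈ DAt r, R γ β j * K γ β j u := by
  rw [quadraticField, sum_eq_sum_symmetricConfigs_add, mul_add]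
  congr 1
  · congr 1
    exact Finset.sum_congr rfl fun a ha => by
      rw [W_of_symmetric γ β (mem_symmetricConfigs.1 ha)]
  · simp only [Finset.mul_sum]
    refine Finset.sum_congr rfl fun r _ => Finset.sum_congr rfl fun j hj => ?_
    rw [W_bar γ β (mem_DAt.1 hj).1, R_eq_Y, W, K]
    push_cast
    ring

lemma isMeanField_W (γ β : Fin p → ℝ) : IsMeanField γ β (W γ β) where
  map_bar hr := W_bar γ β hr
  eq_Q_mul_exp u := by
    rw [neg_half_mul_quadraticField_W, Complex.exp_add, ← mul_assoc]
    rfl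

end Configurations

/-! ## Adding a layer -/

section Layers

variable {p : ℕ}

/-- The configuration with `p + 1` layers that extends `c` by the signs `x` and `y` in the last
layer. -/
def extend (c : Config p) (x y : ℤˣ) : Config (p + 1) :=
  (Fin.snoc (α := fun _ => ℤˣ) c.1 x, Fin.snoc (α := fun _ => ℤˣ) c.2 y)

/-- Configurations with `p + 1` layers as configurations with `p` layers and two more signs. -/
def extendEquiv (p : ℕ) : Config p × ℤˣ × ℤˣ ≃ Config (p + 1) where
  toFun t := extend t.1 t.2.1 t.2.2
  invFun a := ((Fin.init a.1, Fin.init a.2), a.1 (Fin.last p), a.2 (Fin.last p))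
  left_inv t := by simp [extend]
  right_inv a := by simp [extend]

lemma exists_eq_extend (a : Config (p + 1)) : ∃ c x y, a = extend c x y :=
  ⟨_, _, _, ((extendEquiv p).apply_symm_apply a).symm⟩

lemma sum_eq_sum_extend {M : Type*} [AddCommMonoid M] (H : Config (p + 1) → M) :
    ∑ a, H a = ∑ c, ∑ x, ∑ y, H (extend c x y) := by
  rw [← (extendEquiv p).sum_comp, Fintype.sum_prod_type]
  simp only [Fintype.sum_prod_type]
  rfl

lemma sum_units_int {M : Type*} [AddCommMonoid M] (f : ℤˣ → M) : ∑ x, f x = f 1 + f (-1) := by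
  rw [UnitsInt.univ, Finset.sum_pair (by decide)]

lemma starProd_snoc_castSucc (c : Fin p → ℤˣ) (x : ℤˣ) (r : Fin p) :
    starProd (Fin.snoc (α := fun _ => ℤˣ) c x) r.castSucc = starProd c r * sgn x := by
  have prod_Ici : ∀ {q : ℕ} (f : Fin q → ℤˣ) (r : Fin q),
      ∏ s ∈ Finset.Ici r, f s = ∏ s, if r ≤ s then f s else 1 := by
    intro q f r
    rw [← Finset.prod_filter]
    exact Finset.prod_congr (by ext; simp) fun _ _ => rfl
  rw [starProd, starProd, prod_Ici, prod_Ici, Fin.prod_univ_castSucc, ← sgn_mul]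
  simp [Fin.le_last]

lemma starProd_snoc_last (c : Fin p → ℤˣ) (x : ℤˣ) :
    starProd (Fin.snoc (α := fun _ => ℤˣ) c x) (Fin.last p) = sgn x := by
  have : Finset.Ici (Fin.last p) = {Fin.last p} := by
    ext s; simp
  simp [starProd, this]

lemma Phi_extend (γ : Fin (p + 1) → ℝ) (c : Config p) (x y : ℤˣ) :
    Phi γ (extend c x y) = ∑ r, Fin.init γ r * (starProd c.1 r * sgn x - starProd c.2 r * sgn y) +
      γ (Fin.last p) * (sgn x - sgn y) := by
  unfold Phi extend
  rw [Fin.sum_univ_castSucc]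
  simp only [starProd_snoc_castSucc, starProd_snoc_last, Fin.init]

lemma Phi_extend_self (γ : Fin (p + 1) → ℝ) (c : Config p) (x : ℤˣ) :
    Phi γ (extend c x x) = sgn x * Phi (Fin.init γ) c := by
  rw [Phi_extend, sub_self, mul_zero, add_zero, Phi, Finset.mul_sum]
  exact Finset.sum_congr rfl fun r _ => by ring

lemma Phi_extend_neg (γ : Fin (p + 1) → ℝ) (c : Config p) (x y : ℤˣ) :
    Phi γ (extend c (-x) (-y)) = -Phi γ (extend c x y) := by
  rw [Phi_extend, Phi_extend, neg_add, ← Finset.sum_neg_distrib, sgn_neg, sgn_neg]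
  congr 1
  · exact Finset.sum_congr rfl fun r _ => by ring
  · ring

lemma extend_mul (c d : Config p) (x y x' y' : ℤˣ) :
    extend c x y * extend d x' y' = extend (c * d) (x * x') (y * y') := by
  unfold extend
  ext s <;> refine Fin.lastCases ?_ (fun s => ?_) s <;> simp

lemma Phi_extend_neg_mul (γ : Fin (p + 1) → ℝ) (c : Config p) (x y : ℤˣ) (u : Config (p + 1)) :
    Phi γ (extend c (-x) (-y) * u) = -Phi γ (extend c x y * u) := by
  obtain ⟨d, x', y', rfl⟩ := exists_eq_extend u
  rw [extend_mul, extend_mul, neg_mul, neg_mul, Phi_extend_neg]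

lemma Q_extend (β : Fin (p + 1) → ℝ) (c : Config p) (x y : ℤˣ) :
    Q β (extend c x y) = Q (Fin.init β) c * mixFactor (β (Fin.last p)) x y := by
  rw [Q_eq_prod_mixFactor, Q_eq_prod_mixFactor, Fin.prod_univ_castSucc]
  simp [extend, Fin.init]

lemma IsPivot.extend {c : Config p} {r : Fin p} (hr : IsPivot c r) (x : ℤˣ) :
    IsPivot (extend c x x) r.castSucc := by
  unfold SKQAOA.extend
  refine ⟨by simpa using hr.1, fun s => ?_⟩
  refine Fin.lastCases ?_ (fun s => ?_) s
  · simp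
  · intro h
    simpa using hr.2 s (by simpa using h)

lemma IsPivot.bar_extend {c : Config p} {r : Fin p} (hr : IsPivot c r) (x : ℤˣ) :
    SKQAOA.bar (SKQAOA.extend c x x) = SKQAOA.extend (SKQAOA.bar c) x x := by
  have hflip : (Pi.mulSingle r.castSucc (-1) : Fin (p + 1) → ℤˣ) =
      Fin.snoc (α := fun _ => ℤˣ) (Pi.mulSingle r (-1)) 1 := by
    funext s
    refine Fin.lastCases ?_ (fun s => ?_) s
    · simp
    · simp [Pi.mulSingle_apply]
  have hmul := extend_mul c (Pi.mulSingle r (-1), Pi.mulSingle r (-1)) x x 1 1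
  rw [mul_one] at hmul
  rw [(hr.extend x).bar_eq, hr.bar_eq, ← hmul, hflip]
  rfl

lemma isPivot_extend_neg (c : Config p) (x : ℤˣ) : IsPivot (extend c x (-x)) (Fin.last p) := by
  unfold extend
  exact ⟨by simp, fun s hs => absurd hs (not_lt.2 (Fin.le_last s))⟩

lemma bar_extend_neg (c : Config p) (x : ℤˣ) : bar (extend c x (-x)) = extend c (-x) x := by
  rw [(isPivot_extend_neg c x).bar_eq]
  unfold extend
  ext s <;> refine Fin.lastCases ?_ (fun s => ?_) s <;>
    simp [Fin.castSucc_ne_last]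

/-- The weights on configurations with `p` layers obtained by summing out the last layer. Only
equal signs in the last layer are kept: for weights that are odd under the bar operation the
other two terms cancel. -/
def reduce (w : Config (p + 1) → ℂ) (c : Config p) : ℂ :=
  w (extend c 1 1) + w (extend c (-1) (-1))

variable {γ β : Fin (p + 1) → ℝ} {w : Config (p + 1) → ℂ}

lemma IsMeanField.quadraticField_eq (hw : IsMeanField γ β w) (u : Config (p + 1)) :
    quadraticField γ w u = ∑ c, reduce w c * (Phi γ (extend c 1 1 * u) : ℂ) ^ 2 := by
  rw [quadraticField, sum_eq_sum_extend]
  refine Finset.sum_congr rfl fun c _ => ?_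
  have hodd : w (extend c (-1) 1) = -w (extend c 1 (-1)) := by
    rw [← hw.map_bar (isPivot_extend_neg c 1), bar_extend_neg]
  have hneg := Phi_extend_neg_mul γ c 1 1 u
  have hneg' := Phi_extend_neg_mul γ c 1 (-1) u
  rw [neg_neg] at hneg'
  simp only [sum_units_int, hodd, hneg, hneg', reduce]
  push_cast
  ring

lemma IsMeanField.apply_extend_self (hw : IsMeanField γ β w) (u : Config p) (x : ℤˣ) :
    w (extend u x x) = Q (Fin.init β) u * mixFactor (β (Fin.last p)) x x *
      Complex.exp (-(1 / 2) * quadraticField (Fin.init γ) (reduce w) u) := by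
  rw [hw.eq_Q_mul_exp, Q_extend, hw.quadraticField_eq, quadraticField]
  congr 3
  refine Finset.sum_congr rfl fun c _ => ?_
  rw [extend_mul, one_mul, Phi_extend_self, ← Complex.ofReal_pow, mul_pow, sgn_sq, one_mul,
    Complex.ofReal_pow]

lemma IsMeanField.reduce (hw : IsMeanField γ β w) :
    IsMeanField (Fin.init γ) (Fin.init β) (reduce w) where
  map_bar {a r} hr := by
    rw [SKQAOA.reduce, ← hr.bar_extend, ← hr.bar_extend, hw.map_bar (hr.extend 1),
      hw.map_bar (hr.extend (-1)), SKQAOA.reduce]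
    ring
  eq_Q_mul_exp u := by
    conv_lhs => rw [SKQAOA.reduce, hw.apply_extend_self, hw.apply_extend_self]
    rw [← add_mul, ← mul_add, mixFactor_self_add, mul_one]

end Layers

/-! ## Partition functions of fully connected systems -/

section PartitionFunction

lemma ofFn_extend_const_perm {α : Type*} {n k : ℕ} {i : Fin k → Fin n} (hi : Function.Injective i)
    (f : Fin k → α) (a : α) :
    (List.ofFn (Function.extend i f fun _ => a)).Perm
      (List.ofFn f ++ List.replicate (n - k) a) := by
  classical
  have coe_ofFn : ∀ {m : ℕ} (g : Fin m → α),
      (List.ofFn g : Multiset α) = (Finset.univ : Finset (Fin m)).val.map g := fun g => by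
    rw [List.ofFn_eq_map]; rfl
  set S : Finset (Fin n) := Finset.univ.map ⟨i, hi⟩ with hS
  have mem_S : ∀ j, j ∈ S ↔ ∃ l, i l = j := by simp [hS]
  rw [← Multiset.coe_eq_coe, ← Multiset.coe_add, coe_ofFn, coe_ofFn,
    ← Multiset.filter_add_not (· ∈ S) (Finset.univ : Finset (Fin n)).val, Multiset.map_add,
    ← Finset.filter_val, ← Finset.filter_val]
  congr 1
  · rw [Finset.filter_univ_mem, hS, Finset.map_val, Multiset.map_map]
    exact Multiset.map_congr rfl fun l _ => hi.extend_apply f _ l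
  · have hcard : (Finset.univ.filter (· ∉ S)).card = n - k := by
      rw [Finset.filter_not, Finset.filter_univ_mem, ← Finset.compl_eq_univ_sdiff,
        Finset.card_compl, hS, Finset.card_map, Finset.card_univ, Fintype.card_fin,
        Fintype.card_fin]
    rw [Multiset.coe_replicate, Multiset.eq_replicate]
    refine ⟨(Multiset.card_map _ _).trans hcard, fun b hb => ?_⟩
    obtain ⟨j, hj, rfl⟩ := Multiset.mem_map.1 hb
    rw [Finset.mem_val, Finset.mem_filter, mem_S] at hj
    exact Function.extend_apply' _ _ _ hj.2

variable {T A : Type*} [CommSemiring A]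

/-- The weight of the states `s` of a fully connected system with pair interaction `φ` and
single-site weight `q`. -/
def gibbsWeight (φ : T → T → A) (q : T → A) {n : ℕ} (s : Fin n → T) : A :=
  (∏ j, q (s j)) * ∏ i, ∏ j ∈ Finset.Ioi i, φ (s i) (s j)

/-- The product of the pair interactions `φ` among sites in the listed states. -/
def pairProd (φ : T → T → A) : List T → A
  | [] => 1
  | t :: L => (L.map (φ t)).prod * pairProd φ L

variable [Fintype T] {φ : T → T → A}

/-- The partition function of a fully connected system with pair interaction `φ` in an external
field `h`, with one site for every single-site weight in the list. -/
def partitionFunction (φ : T → T → A) : (T → A) → List (T → A) → A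
  | _, [] => 1
  | h, u :: L => ∑ t, u t * h t * partitionFunction φ (fun s => h s * φ t s) L

@[simp] lemma partitionFunction_nil (h : T → A) : partitionFunction φ h [] = 1 := rfl

lemma partitionFunction_cons (h u : T → A) (L : List (T → A)) :
    partitionFunction φ h (u :: L) =
      ∑ t, u t * h t * partitionFunction φ (fun s => h s * φ t s) L := rfl

lemma partitionFunction_perm (hφ : ∀ s t, φ s t = φ t s) {L L' : List (T → A)} (hL : L.Perm L')
    (h : T → A) : partitionFunction φ h L = partitionFunction φ h L' := by
  induction hL generalizing h with
  | nil => rfl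
  | cons u _ ih => simp only [partitionFunction_cons, ih]
  | swap u v L =>
    simp only [partitionFunction_cons, Finset.mul_sum]
    rw [Finset.sum_comm]
    refine Finset.sum_congr rfl fun s _ => Finset.sum_congr rfl fun t _ => ?_
    rw [show (fun r => h r * φ t r * φ s r) = fun r => h r * φ s r * φ t r from
      funext fun r => mul_right_comm _ _ _, hφ t s]
    ring
  | trans _ _ ih1 ih2 => rw [ih1, ih2]

lemma partitionFunction_append_add_cons (h u v : T → A) (L L' : List (T → A)) :
    partitionFunction φ h (L ++ (u + v) :: L') =
      partitionFunction φ h (L ++ u :: L') + partitionFunction φ h (L ++ v :: L') := by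
  induction L generalizing h with
  | nil => simp [partitionFunction_cons, add_mul, Finset.sum_add_distrib]
  | cons x L ih => simp [partitionFunction_cons, ih, mul_add, Finset.sum_add_distrib]

lemma partitionFunction_mul_field (g h : T → A) (L : List (T → A)) :
    partitionFunction φ (fun s => g s * h s) L =
      partitionFunction φ g (L.map fun u s => u s * h s) := by
  induction L generalizing g with
  | nil => rfl
  | cons u L ih =>
    simp only [List.map_cons, partitionFunction_cons]
    refine Finset.sum_congr rfl fun t _ => ?_
    rw [← ih, show (fun s => g s * h s * φ t s) = fun s => g s * φ t s * h s from
      funext fun s => mul_right_comm _ _ _]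
    ring

lemma partitionFunction_replicate_succ_add (hφ : ∀ s t, φ s t = φ t s) (h u v : T → A)
    (m i j : ℕ) :
    partitionFunction φ h
        (List.replicate (m + 1) (u + v) ++ (List.replicate i v ++ List.replicate j u)) =
      partitionFunction φ h
          (List.replicate m (u + v) ++ (List.replicate i v ++ List.replicate (j + 1) u)) +
        partitionFunction φ h
          (List.replicate m (u + v) ++ (List.replicate (i + 1) v ++ List.replicate j u)) := by
  rw [List.replicate_succ', List.append_assoc, List.singleton_append,
    partitionFunction_append_add_cons]
  congr 1
  refine partitionFunction_perm hφ (List.Perm.append_left _ ?_) h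
  rw [List.replicate_succ]
  exact List.perm_middle.symm

-- The trailing copies of `v` and `u` are what the induction on `m` needs.
lemma partitionFunction_replicate_add_append (hφ : ∀ s t, φ s t = φ t s) (h u v : T → A)
    (m i j : ℕ) :
    partitionFunction φ h
        (List.replicate m (u + v) ++ (List.replicate i v ++ List.replicate j u)) =
      ∑ ab ∈ Finset.HasAntidiagonal.antidiagonal m, (m.choose ab.1 : A) *
        partitionFunction φ h (List.replicate (i + ab.1) v ++ List.replicate (j + ab.2) u) := by
  induction m generalizing i j with
  | zero => simp
  | succ m ih =>
    rw [Finset.sum_antidiagonal_choose_succ_mul fun a b =>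
        partitionFunction φ h (List.replicate (i + a) v ++ List.replicate (j + b) u),
      partitionFunction_replicate_succ_add hφ, ih i (j + 1), ih (i + 1) j]
    congr 1
    · exact Finset.sum_congr rfl fun ab _ => by rw [add_right_comm j, add_assoc j]
    · refine Finset.sum_congr rfl fun ab hab => ?_
      rw [Nat.choose_symm_of_eq_add (Finset.HasAntidiagonal.mem_antidiagonal.1 hab).symm,
        add_right_comm i, add_assoc i]

lemma partitionFunction_replicate_add (hφ : ∀ s t, φ s t = φ t s) (h u v : T → A) (m : ℕ) :
    partitionFunction φ h (List.replicate m (u + v)) =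
      ∑ k ∈ Finset.range (m + 1), (m.choose k : A) *
        partitionFunction φ h (List.replicate k v ++ List.replicate (m - k) u) := by
  have h₀ := partitionFunction_replicate_add_append hφ h u v m 0 0
  simp only [List.replicate_zero, List.append_nil, zero_add] at h₀
  rw [h₀, Finset.Nat.sum_antidiagonal_eq_sum_range_succ_mk]

lemma partitionFunction_ofFn (n : ℕ) (h : T → A) (u : Fin n → T → A) :
    partitionFunction φ h (List.ofFn u) =
      ∑ s : Fin n → T, (∏ j, u j (s j) * h (s j)) * ∏ i, ∏ j ∈ Finset.Ioi i, φ (s i) (s j) := by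
  induction n generalizing h with
  | zero => simp
  | succ n ih =>
    rw [← (Fin.consEquiv fun _ : Fin (n + 1) => T).sum_comp, Fintype.sum_prod_type,
      List.ofFn_succ, partitionFunction_cons]
    refine Finset.sum_congr rfl fun t _ => ?_
    rw [ih, Finset.mul_sum]
    refine Finset.sum_congr rfl fun s _ => ?_
    simp only [Fin.consEquiv_apply, Fin.prod_univ_succ, Fin.cons_zero,
      Fin.cons_succ, Fin.prod_Ioi_zero, Fin.prod_Ioi_succ, Finset.prod_mul_distrib]
    ring

variable [DecidableEq T]

/-- The single-site weight `q` restricted to the state `t`, for a site whose state is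
prescribed. -/
def pinned (q : T → A) (t : T) : T → A := Pi.single t (q t)

lemma partitionFunction_pinned_cons (q h : T → A) (t : T) (L : List (T → A)) :
    partitionFunction φ h (pinned q t :: L) =
      q t * h t * partitionFunction φ (fun s => h s * φ t s) L := by
  rw [partitionFunction_cons, Finset.sum_eq_single t]
  · simp [pinned]
  · intro s _ hs; simp [pinned, hs]
  · simp

lemma partitionFunction_replicate_append (q e h : T → A) (k : ℕ) (L : List (T → A)) :
    partitionFunction φ h (List.replicate k (fun t => q t * e t) ++ L) =
      ∑ t : Fin k → T, (∏ i, e (t i)) *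
        partitionFunction φ h ((List.ofFn t).map (pinned q) ++ L) := by
  induction k generalizing h with
  | zero => simp
  | succ k ih =>
    rw [← (Fin.consEquiv fun _ : Fin (k + 1) => T).sum_comp, Fintype.sum_prod_type,
      List.replicate_succ, List.cons_append, partitionFunction_cons]
    refine Finset.sum_congr rfl fun t _ => ?_
    rw [ih, Finset.mul_sum]
    refine Finset.sum_congr rfl fun s _ => ?_
    simp only [Fin.consEquiv_apply, Fin.prod_univ_succ, List.ofFn_succ, Fin.cons_zero,
      Fin.cons_succ, List.map_cons, List.cons_append, partitionFunction_pinned_cons]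
    ring

lemma partitionFunction_map_pinned_append (q h : T → A) (L : List T) (M : List (T → A)) :
    partitionFunction φ h (L.map (pinned q) ++ M) =
      (L.map q).prod * (L.map h).prod * pairProd φ L *
        partitionFunction φ (fun s => h s * (L.map fun t => φ t s).prod) M := by
  induction L generalizing h with
  | nil => simp [pairProd]
  | cons t L ih =>
    rw [List.map_cons, List.cons_append, partitionFunction_pinned_cons, ih]
    simp only [List.map_cons, List.prod_cons, pairProd, List.prod_map_mul, mul_assoc]
    ring

lemma partitionFunction_map_pinned_ofFn_append_replicate (hφ : ∀ s t, φ s t = φ t s) {n k : ℕ}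
    (q : T → A) {i : Fin k → Fin n} (hi : Function.Injective i) (t : Fin k → T) :
    partitionFunction φ (fun _ => 1)
        ((List.ofFn t).map (pinned q) ++ List.replicate (n - k) q) =
      ∑ s : Fin n → T, if s ∘ i = t then gibbsWeight φ q s else 0 := by
  rw [List.map_ofFn, ← partitionFunction_perm hφ (ofFn_extend_const_perm hi _ q),
    partitionFunction_ofFn]
  refine Finset.sum_congr rfl fun s _ => ?_
  split_ifs with hs
  · unfold gibbsWeight
    congr 1
    refine Finset.prod_congr rfl fun j _ => ?_
    by_cases hj : ∃ l, i l = j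
    · obtain ⟨l, rfl⟩ := hj
      rw [hi.extend_apply]
      simp [pinned, ← hs]
    · rw [Function.extend_apply' _ _ _ hj, mul_one]
  · obtain ⟨l, hl⟩ := Function.ne_iff.1 hs
    rw [Finset.prod_eq_zero (Finset.mem_univ (i l)), zero_mul]
    rw [hi.extend_apply]
    simp only [Function.comp_apply] at hl
    simp [pinned, Pi.single_eq_of_ne hl]

lemma sum_comp_mul_gibbsWeight (hφ : ∀ s t, φ s t = φ t s) {n k : ℕ} (q : T → A)
    {i : Fin k → Fin n} (hi : Function.Injective i) (G : (Fin k → T) → A) :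
    ∑ s : Fin n → T, G (s ∘ i) * gibbsWeight φ q s =
      ∑ t : Fin k → T, G t * partitionFunction φ (fun _ => 1)
        ((List.ofFn t).map (pinned q) ++ List.replicate (n - k) q) := by
  simp only [partitionFunction_map_pinned_ofFn_append_replicate hφ q hi, Finset.mul_sum]
  rw [Finset.sum_comm]
  refine Finset.sum_congr rfl fun s _ => ?_
  simp

end PartitionFunction

/-! ## Histories of a single qubit -/

section Sites

variable {p : ℕ}

/-- The history of one qubit: the configuration of its sign changes and its final sign. -/
abbrev Site (p : ℕ) : Type := Config p × ℤˣ

lemma sum_site {M : Type*} [AddCommMonoid M] (f : Site p → M) :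
    ∑ t, f t = ∑ c, ∑ z, f (c, z) :=
  Fintype.sum_prod_type f

/-- The amplitude of the history of one qubit that no coupling acts on. -/
def siteWeight (β : Fin p → ℝ) (t : Site p) : ℂ := Q β t.1 / 2

/-- The phase that two histories pick up per unit of coupling. -/
def phase (γ : Fin p → ℝ) (s t : Site p) : ℝ := sgn s.2 * sgn t.2 * Phi γ (s.1 * t.1)

lemma phase_comm (γ : Fin p → ℝ) (s t : Site p) : phase γ s t = phase γ t s := by
  rw [phase, phase, Phi_mul_comm]; ring

/-- Functions of a history that do not depend on the sign after the last layer. The signs before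
that layer are unaffected by flipping the final sign and both sign changes in the last layer. -/
def IgnoresFinal {M : Type*} (f : Site (p + 1) → M) : Prop :=
  ∀ c x y z, f (extend c (-x) (-y), -z) = f (extend c x y, z)

/-- The history with `p + 1` layers in which nothing happens in the last layer. -/
def lift (t : Site p) : Site (p + 1) := (extend t.1 1 1, t.2)

lemma phase_lift (γ : Fin (p + 1) → ℝ) (s t : Site p) :
    phase γ (lift s) (lift t) = phase (Fin.init γ) s t := by
  simp [phase, lift, extend_mul, Phi_extend_self]

lemma ignoresFinal_phase (γ : Fin (p + 1) → ℝ) (t : Site (p + 1)) :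
    IgnoresFinal fun s => phase γ s t := by
  intro c x y z
  simp only [phase, Phi_extend_neg_mul, sgn_neg]
  ring

lemma mixFactor_one_neg_one_add (β : ℝ) : mixFactor β 1 (-1) + mixFactor β (-1) 1 = 0 := by
  rw [mixFactor_neg_self, add_neg_cancel]

-- Unitarity of the last mixer: what it does is invisible to functions that ignore the final sign.
lemma sum_siteWeight_mul (β : Fin (p + 1) → ℝ) {f : Site (p + 1) → ℂ} (hf : IgnoresFinal f) :
    ∑ t, siteWeight β t * f t = ∑ t, siteWeight (Fin.init β) t * f (lift t) := by
  rw [sum_site, sum_eq_sum_extend, sum_site]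
  refine Finset.sum_congr rfl fun c _ => ?_
  have hsame : ∀ z, f (extend c (-1) (-1), z) = f (extend c 1 1, -z) := fun z => by
    simpa only [neg_neg] using hf c 1 1 (-z)
  have hopposite : ∀ z, f (extend c (-1) 1, z) = f (extend c 1 (-1), -z) := fun z => by
    simpa only [neg_neg] using hf c 1 (-1) (-z)
  simp only [sum_units_int, siteWeight, Q_extend, lift, hsame, hopposite, neg_neg]
  linear_combination
    (Q (Fin.init β) c / 2 * (f (extend c 1 1, 1) + f (extend c 1 1, -1))) *
      mixFactor_self_add (β (Fin.last p)) +
    (Q (Fin.init β) c / 2 * (f (extend c 1 (-1), 1) + f (extend c 1 (-1), -1))) *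
      mixFactor_one_neg_one_add (β (Fin.last p))

lemma partitionFunction_lift (β : Fin (p + 1) → ℝ) {φ' : Site (p + 1) → Site (p + 1) → ℂ}
    {φ : Site p → Site p → ℂ} (hφ : ∀ s t, φ' (lift s) (lift t) = φ s t)
    (hleft : IgnoresFinal φ') (hright : ∀ s, IgnoresFinal (φ' s))
    (L : List (Site (p + 1) → ℂ)) (hL : ∀ f ∈ L, IgnoresFinal f) (h : Site (p + 1) → ℂ)
    (hh : IgnoresFinal h) :
    partitionFunction φ' h (L.map fun f t => siteWeight β t * f t) =
      partitionFunction φ (fun t => h (lift t))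
        (L.map fun f t => siteWeight (Fin.init β) t * f (lift t)) := by
  induction L generalizing h with
  | nil => rfl
  | cons f L ih =>
    have hf : IgnoresFinal f := hL f List.mem_cons_self
    have hsum : IgnoresFinal fun t => f t * h t * partitionFunction φ'
        (fun s => h s * φ' t s) (L.map fun f t => siteWeight β t * f t) := by
      intro c x y z
      simp only [hf c x y z, hh c x y z, hleft c x y z]
    have ih' := fun t => ih (fun g hg => hL g (List.mem_cons_of_mem f hg))
      (fun s => h s * φ' (lift t) s) fun c x y z => by simp only [hh c x y z, hright _ c x y z]
    simp only [List.map_cons, partitionFunction_cons, mul_assoc] at hsum ⊢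
    simp only [sum_siteWeight_mul β hsum, ih', hφ]

end Sites

/-! ## Fourier transforms of the law of a coupling -/

section FourierMoments

variable {ν : Measure ℝ}

/-- The mixed moment `E[J^k exp(i t J)]` of a random variable `J` with law `ν`. -/
def fourierMoment (ν : Measure ℝ) (k : ℕ) (t : ℝ) : ℂ :=
  ∫ x, (x : ℂ) ^ k * Complex.exp (t * x * Complex.I) ∂ν

lemma fourierMoment_zero (t : ℝ) : fourierMoment ν 0 t = charFun ν t := by
  simp [fourierMoment, charFun_apply_real]

lemma norm_exp_mul_mul_I (t x : ℝ) : ‖Complex.exp (t * x * Complex.I)‖ = 1 := by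
  exact_mod_cast Complex.norm_exp_ofReal_mul_I (t * x)

lemma integrable_pow_mul_exp [IsFiniteMeasure ν] {k m : ℕ} (hν : MemLp id m ν) (hk : k ≤ m)
    (t : ℝ) : Integrable (fun x : ℝ => (x : ℂ) ^ k * Complex.exp (t * x * Complex.I)) ν := by
  have hpow : Integrable (fun x : ℝ => ‖x‖ ^ k) ν := by
    rcases eq_or_ne k 0 with rfl | hk₀
    · simp
    · exact (hν.mono_exponent (by exact_mod_cast hk)).integrable_norm_pow hk₀
  refine hpow.mono' ?_ (ae_of_all _ fun x => ?_)
  · exact (by fun_prop : Continuous fun x : ℝ =>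
      (x : ℂ) ^ k * Complex.exp (t * x * Complex.I)).aestronglyMeasurable
  · simp [norm_exp_mul_mul_I]

lemma integrable_ofReal_id [IsFiniteMeasure ν] (hν : MemLp id 2 ν) :
    Integrable (fun x : ℝ => (x : ℂ)) ν := by
  simpa using integrable_pow_mul_exp hν one_le_two 0

lemma norm_exp_mul_I_sub_one_sub_le (x : ℝ) :
    ‖Complex.exp (x * Complex.I) - 1 - x * Complex.I‖ ≤ 3 * x ^ 2 := by
  rcases le_or_gt |x| 1 with h | h
  · refine (Complex.norm_exp_sub_one_sub_id_le (x := x * Complex.I) (by simpa using h)).trans ?_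
    simp only [norm_mul, Complex.norm_real, Real.norm_eq_abs, Complex.norm_I, mul_one, sq_abs]
    linarith [sq_nonneg x]
  · have htriangle : ‖Complex.exp (x * Complex.I) - 1 - x * Complex.I‖ ≤ 1 + 1 + |x| := by
      refine (norm_sub_le _ _).trans (add_le_add ((norm_sub_le _ _).trans ?_) ?_)
      · simp [Complex.norm_exp_ofReal_mul_I]
      · simp
    nlinarith [sq_abs x]

lemma norm_charFun_sub_one_le [IsProbabilityMeasure ν] (hν : MemLp id 2 ν)
    (hmean : ∫ x, x ∂ν = 0) (t : ℝ) : ‖charFun ν t - 1‖ ≤ 3 * t ^ 2 * ∫ x, x ^ 2 ∂ν := by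
  have hexp : Integrable (fun x : ℝ => Complex.exp (t * x * Complex.I)) ν := by
    simpa using integrable_pow_mul_exp hν (Nat.zero_le 2) t
  have hexp_sub : Integrable (fun x : ℝ => Complex.exp (t * x * Complex.I) - 1) ν :=
    hexp.sub (integrable_const _)
  have hcentred : charFun ν t - 1 =
      ∫ x, (Complex.exp (t * x * Complex.I) - 1 - x * (t * Complex.I)) ∂ν := by
    rw [integral_sub hexp_sub ((integrable_ofReal_id hν).mul_const _),
      integral_sub hexp (integrable_const _), integral_mul_const, integral_complex_ofReal, hmean,
      charFun_apply_real]
    simp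
  rw [hcentred, ← integral_const_mul]
  refine norm_integral_le_of_norm_le (hν.integrable_sq.const_mul _) (ae_of_all _ fun x => ?_)
  have hpointwise := norm_exp_mul_I_sub_one_sub_le (t * x)
  push_cast at hpointwise
  rw [show (x : ℂ) * (t * Complex.I) = t * x * Complex.I by ring]
  rwa [mul_pow, ← mul_assoc] at hpointwise

lemma norm_fourierMoment_one_le [IsProbabilityMeasure ν] (hν : MemLp id 2 ν)
    (hmean : ∫ x, x ∂ν = 0) (t : ℝ) : ‖fourierMoment ν 1 t‖ ≤ |t| * ∫ x, x ^ 2 ∂ν := by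
  have hmul_exp : Integrable (fun x : ℝ => x * Complex.exp (t * x * Complex.I)) ν := by
    simpa using integrable_pow_mul_exp hν one_le_two t
  have hcentred : fourierMoment ν 1 t =
      ∫ x : ℝ, (x * Complex.exp (t * x * Complex.I) - x : ℂ) ∂ν := by
    rw [integral_sub hmul_exp (integrable_ofReal_id hν), integral_complex_ofReal, hmean,
      fourierMoment]
    simp
  rw [hcentred, ← integral_const_mul]
  refine norm_integral_le_of_norm_le (hν.integrable_sq.const_mul _) (ae_of_all _ fun x => ?_)
  rw [show (x : ℂ) * Complex.exp (t * x * Complex.I) - x =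
    x * (Complex.exp (Complex.I * (t * x : ℝ)) - 1) by
      push_cast; rw [mul_comm Complex.I]; ring, norm_mul, Complex.norm_real]
  calc ‖x‖ * ‖Complex.exp (Complex.I * (t * x : ℝ)) - 1‖
      ≤ ‖x‖ * ‖t * x‖ := by
        gcongr
        exact Real.norm_exp_I_mul_ofReal_sub_one_le
    _ = |t| * id x ^ 2 := by
        rw [norm_mul, Real.norm_eq_abs, Real.norm_eq_abs, id, ← sq_abs x]
        ring

lemma norm_fourierMoment_le (k : ℕ) (t : ℝ) : ‖fourierMoment ν k t‖ ≤ ∫ x, |x| ^ k ∂ν := by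
  refine (norm_integral_le_integral_norm _).trans (le_of_eq ?_)
  simp [norm_exp_mul_mul_I]

lemma tendsto_div_sqrt (x : ℝ) : Tendsto (fun n : ℕ => x / √n) atTop (𝓝 0) :=
  Tendsto.const_div_atTop (Real.tendsto_sqrt_atTop.comp tendsto_natCast_atTop_atTop) x

lemma tendsto_sqrt_pow_mul_of_isLittleO {r : ℝ → ℂ} {k : ℕ}
    (hr : r =o[𝓝 0] fun t : ℝ => t ^ k) (x : ℝ) :
    Tendsto (fun n : ℕ => (√n : ℂ) ^ k * r (x / √n)) atTop (𝓝 0) := by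
  have hsqrt : (fun n : ℕ => (√n : ℂ) ^ k) =O[atTop] fun n : ℕ => √n ^ k :=
    Asymptotics.IsBigO.of_bound 1 (Eventually.of_forall fun n => by simp)
  have hbounded : (fun n : ℕ => √n ^ k * ((fun t : ℝ => t ^ k) ∘ fun n : ℕ => x / √n) n)
      =O[atTop] fun _ => (1 : ℝ) := by
    refine Asymptotics.IsBigO.of_bound |x ^ k| ?_
    filter_upwards [eventually_gt_atTop 0] with n hn
    have : √(n : ℝ) ≠ 0 := (Real.sqrt_pos.2 (by exact_mod_cast hn)).ne'
    simp only [Function.comp]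
    rw [div_pow, mul_div_cancel₀ _ (pow_ne_zero _ this)]
    simp
  exact (Asymptotics.isLittleO_one_iff ℝ).1
    ((hsqrt.mul_isLittleO (hr.comp_tendsto (tendsto_div_sqrt x))).trans_isBigO hbounded)

lemma tendsto_natCast_mul_charFun_sub_one [IsProbabilityMeasure ν]
    (hmean : ∫ x, x ∂ν = 0) (hvar : ∫ x, x ^ 2 ∂ν = 1) (x : ℝ) :
    Tendsto (fun n : ℕ => (n : ℂ) * (charFun ν (x / √n) - 1)) atTop (𝓝 (-(x : ℂ) ^ 2 / 2)) := by
  have htaylor := taylor_charFun_two (P := ν) (X := id) aemeasurable_id hmean hvar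
  rw [Measure.map_id] at htaylor
  have hlim := (tendsto_sqrt_pow_mul_of_isLittleO htaylor x).add_const (-(x : ℂ) ^ 2 / 2)
  rw [zero_add] at hlim
  refine hlim.congr' ?_
  filter_upwards [eventually_gt_atTop 0] with n hn
  have hsq : (√(n : ℝ) : ℂ) ^ 2 = n := by
    rw [← Complex.ofReal_pow, Real.sq_sqrt (Nat.cast_nonneg n)]; simp
  have hn₀ : (n : ℂ) ≠ 0 := by exact_mod_cast hn.ne'
  push_cast
  rw [div_pow, hsq]
  field_simp
  ring

lemma deriv_charFun_eq [IsProbabilityMeasure ν] (hν : MemLp id 1 ν) (t : ℝ) :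
    deriv (charFun ν) t = Complex.I * fourierMoment ν 1 t := by
  have h := iteratedDeriv_charFun (μ := ν) (n := 1) (t := t) (by exact_mod_cast hν)
  rw [iteratedDeriv_one] at h
  rw [h, fourierMoment, pow_one]

lemma hasDerivAt_fourierMoment_one_zero [IsProbabilityMeasure ν] (hν : MemLp id 2 ν) :
    HasDerivAt (fourierMoment ν 1) (Complex.I * ∫ x, x ^ 2 ∂ν) 0 := by
  have hsecond : deriv (deriv (charFun ν)) 0 = -∫ x, x ^ 2 ∂ν := by
    have h := iteratedDeriv_charFun_zero (μ := ν) (n := 2) (by exact_mod_cast hν)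
    rw [iteratedDeriv_succ, iteratedDeriv_one] at h
    simpa using h
  have hsmooth : ContDiff ℝ (1 + 1) (charFun ν) := by
    exact_mod_cast contDiff_charFun (μ := ν) (n := 2) (by exact_mod_cast hν)
  have hdiff : DifferentiableAt ℝ (deriv (charFun ν)) 0 :=
    (contDiff_succ_iff_deriv.1 hsmooth).2.2.differentiable (by norm_num) 0
  have hmoment : fourierMoment ν 1 = fun t => -Complex.I * deriv (charFun ν) t := by
    funext t
    rw [deriv_charFun_eq (hν.mono_exponent one_le_two), ← mul_assoc]
    simp
  have hderiv := hdiff.hasDerivAt.const_mul (-Complex.I)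
  rwa [hsecond, neg_mul_neg, ← hmoment] at hderiv

lemma tendsto_sqrt_mul_fourierMoment_one [IsProbabilityMeasure ν] (hν : MemLp id 2 ν)
    (hmean : ∫ x, x ∂ν = 0) (hvar : ∫ x, x ^ 2 ∂ν = 1) (x : ℝ) :
    Tendsto (fun n : ℕ => (√n : ℂ) * fourierMoment ν 1 (x / √n)) atTop (𝓝 (Complex.I * x)) := by
  have hzero : fourierMoment ν 1 0 = 0 := by
    simpa using norm_fourierMoment_one_le hν hmean 0
  have hderiv := hasDerivAt_iff_isLittleO.1 (hasDerivAt_fourierMoment_one_zero hν)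
  rw [hvar] at hderiv
  have hlittle : (fun t : ℝ => fourierMoment ν 1 t - t * Complex.I) =o[𝓝 0]
      fun t : ℝ => t ^ 1 := by
    simpa [hzero] using hderiv
  have hlim := (tendsto_sqrt_pow_mul_of_isLittleO hlittle x).add_const (Complex.I * x)
  rw [zero_add] at hlim
  refine hlim.congr' ?_
  filter_upwards [eventually_gt_atTop 0] with n hn
  have hsqrt : (√(n : ℝ) : ℂ) ≠ 0 := by
    exact_mod_cast (Real.sqrt_pos.2 (by exact_mod_cast hn : (0 : ℝ) < n)).ne'
  push_cast
  field_simp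
  ring

end FourierMoments

/-! ## Products over lists -/

section ListProducts

variable {α E : Type*}

lemma norm_list_prod_map_le [SeminormedRing E] [NormOneClass E] {f : α → E} {A : ℝ} (hA : 0 ≤ A)
    (hf : ∀ x, ‖f x‖ ≤ A) (L : List α) : ‖(L.map f).prod‖ ≤ A ^ L.length := by
  induction L with
  | nil => simp
  | cons x L ih =>
    rw [List.map_cons, List.prod_cons, List.length_cons, pow_succ']
    exact (norm_mul_le _ _).trans (mul_le_mul (hf x) ih (norm_nonneg _) hA)

lemma norm_list_prod_map_le_one [SeminormedRing E] [NormOneClass E] {f : α → E}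
    (hf : ∀ x, ‖f x‖ ≤ 1) (L : List α) : ‖(L.map f).prod‖ ≤ 1 :=
  (norm_list_prod_map_le zero_le_one hf L).trans_eq (one_pow _)

lemma norm_list_prod_map_sub_one_le [SeminormedRing E] {f : α → E} {δ : ℝ}
    (hf : ∀ x, ‖f x‖ ≤ 1) (hδ : ∀ x, ‖f x - 1‖ ≤ δ) (L : List α) :
    ‖(L.map f).prod - 1‖ ≤ L.length * δ := by
  induction L with
  | nil => simp
  | cons x L ih =>
    rw [List.map_cons, List.prod_cons, List.length_cons,
      show f x * (L.map f).prod - 1 = f x * ((L.map f).prod - 1) + (f x - 1) by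
        rw [mul_sub, mul_one, sub_add_sub_cancel]]
    calc ‖f x * ((L.map f).prod - 1) + (f x - 1)‖
        ≤ ‖f x‖ * ‖(L.map f).prod - 1‖ + ‖f x - 1‖ :=
          (norm_add_le _ _).trans (add_le_add_left (norm_mul_le _ _) _)
      _ ≤ 1 * (L.length * δ) + δ := by gcongr <;> simp only [hf, hδ]
      _ = (L.length + 1 : ℕ) * δ := by push_cast; ring

lemma norm_pairProd_le_one [SeminormedCommRing E] [NormOneClass E] {φ : α → α → E}
    (hφ : ∀ s t, ‖φ s t‖ ≤ 1) (L : List α) : ‖pairProd φ L‖ ≤ 1 := by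
  induction L with
  | nil => simp [pairProd]
  | cons t L ih =>
    exact (norm_mul_le _ _).trans
      (mul_le_one₀ (norm_list_prod_map_le_one (hφ t) L) (norm_nonneg _) ih)

lemma tendsto_pairProd {ι : Type*} {l : Filter ι} [CommSemiring E] [TopologicalSpace E]
    [ContinuousMul E] {φ : ι → α → α → E} {ψ : α → α → E}
    (h : ∀ s t, Tendsto (fun n => φ n s t) l (𝓝 (ψ s t))) (L : List α) :
    Tendsto (fun n => pairProd (φ n) L) l (𝓝 (pairProd ψ L)) := by
  induction L with
  | nil => exact tendsto_const_nhds
  | cons t L ih => exact (tendsto_list_prod L fun s _ => h t s).mul ih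

lemma pairProd_one [CommSemiring E] (L : List α) : pairProd (fun _ _ => (1 : E)) L = 1 := by
  induction L with
  | nil => rfl
  | cons t L ih => simp [pairProd, ih]

lemma tendsto_mul_list_prod_map_sub_one {ι : Type*} {l : Filter ι} [CommRing E]
    [TopologicalSpace E] [IsTopologicalRing E] {c : ι → E} {f : ι → α → E} {g : α → E}
    (hf : ∀ x, Tendsto (fun n => f n x) l (𝓝 1))
    (hg : ∀ x, Tendsto (fun n => c n * (f n x - 1)) l (𝓝 (g x))) (L : List α) :
    Tendsto (fun n => c n * ((L.map (f n)).prod - 1)) l (𝓝 (L.map g).sum) := by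
  induction L with
  | nil => simpa using tendsto_const_nhds
  | cons x L ih =>
    have h := ((hf x).mul ih).add (hg x)
    rw [one_mul, add_comm] at h
    simp only [List.map_cons, List.prod_cons, List.sum_cons]
    refine h.congr fun n => ?_
    ring

lemma sum_list_sum_mul {T : Type*} [Fintype T] [NonUnitalNonAssocSemiring E] (a : α → T → E)
    (b : T → E) (L : List α) :
    ∑ t, (L.map fun s => a s t).sum * b t = (L.map fun s => ∑ t, a s t * b t).sum := by
  induction L with
  | nil => simp
  | cons s L ih => simp [add_mul, Finset.sum_add_distrib, ih]

end ListProducts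

lemma tendsto_natCast_sub_div (d : ℕ) :
    Tendsto (fun n : ℕ => ((n - d : ℕ) : ℝ) / n) atTop (𝓝 1) := by
  have h : Tendsto (fun n : ℕ => 1 - (d : ℝ) / n) atTop (𝓝 (1 - 0)) :=
    tendsto_const_nhds.sub (tendsto_const_div_atTop_nhds_zero_nat _)
  rw [sub_zero] at h
  refine h.congr' ?_
  filter_upwards [eventually_gt_atTop d] with n hn
  have : (n : ℝ) ≠ 0 := by exact_mod_cast (by omega : n ≠ 0)
  rw [Nat.cast_sub hn.le]
  field_simp

lemma tendsto_choose_div_pow (d k : ℕ) :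
    Tendsto (fun n : ℕ => ((n - d).choose k : ℝ) / n ^ k) atTop (𝓝 (1 / k.factorial)) := by
  have h : Tendsto (fun n : ℕ => (∏ i ∈ Finset.range k, ((n - (d + i) : ℕ) : ℝ) / n) /
      k.factorial) atTop (𝓝 ((∏ i ∈ Finset.range k, 1) / k.factorial)) :=
    (tendsto_finsetProd _ fun i _ => tendsto_natCast_sub_div (d + i)).div_const _
  rw [Finset.prod_const_one] at h
  refine h.congr fun n => ?_
  rw [Nat.choose_eq_descFactorial_div_factorial, Nat.cast_div
    (Nat.factorial_dvd_descFactorial _ _) (by exact_mod_cast k.factorial_ne_zero),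
    Nat.descFactorial_eq_prod_range, Finset.prod_div_distrib, Finset.prod_const,
    Finset.card_range]
  push_cast
  simp only [Nat.sub_sub]
  ring

/-! ## Marginals of the averaged system -/

/-- A law with mean `0` and variance `1`. -/
structure IsStandardized (ν : Measure ℝ) : Prop where
  memLp : MemLp id 2 ν
  mean_eq_zero : ∫ x, x ∂ν = 0
  integral_sq_eq_one : ∫ x, x ^ 2 ∂ν = 1

lemma IsStandardized.memLp_of_le {ν : Measure ℝ} [IsFiniteMeasure ν] (hν : IsStandardized ν)
    {k : ℕ} (hk : k ≤ 2) : MemLp id k ν :=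
  hν.memLp.mono_exponent (by exact_mod_cast hk)

section Marginals

variable {p : ℕ}

/-- The average of `exp(i J x / √n)` for the phase `x` of two histories. -/
def interaction (ν : Measure ℝ) (γ : Fin p → ℝ) (n : ℕ) (s t : Site p) : ℂ :=
  charFun ν (phase γ s t / √n)

/-- The marginal, at sites in the states `L`, of the averaged system with `m` further sites. -/
def marginal (ν : Measure ℝ) (γ β : Fin p → ℝ) (n : ℕ) (L : List (Site p)) (m : ℕ) : ℂ :=
  partitionFunction (interaction ν γ n) (fun _ => 1)
    (L.map (pinned (siteWeight β)) ++ List.replicate m (siteWeight β))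

/-- The deviation from `1` of the field exerted by sites in the states `L`. -/
def fieldDeviation (ν : Measure ℝ) (γ : Fin p → ℝ) (n : ℕ) (L : List (Site p)) (s : Site p) : ℂ :=
  (L.map fun t => interaction ν γ n t s).prod - 1

/-- The contribution to the marginal at `L` of the choices of `k` among the `m` further sites that
feel the deviation of the field of `L`, the others feeling no field from `L`. The last layer is
already summed out at the further sites. -/
def expansionTerm (ν : Measure ℝ) (γ β : Fin (p + 1) → ℝ) (n : ℕ) (L : List (Site (p + 1)))
    (m k : ℕ) : ℂ :=
  (m.choose k : ℂ) * ∑ t : Fin k → Site p, (∏ i, fieldDeviation ν γ n L (lift (t i))) *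
    marginal ν (Fin.init γ) (Fin.init β) n (List.ofFn t) (m - k)

lemma interaction_comm (ν : Measure ℝ) (γ : Fin p → ℝ) (n : ℕ) (s t : Site p) :
    interaction ν γ n s t = interaction ν γ n t s := by
  rw [interaction, interaction, phase_comm]

lemma interaction_lift (ν : Measure ℝ) (γ : Fin (p + 1) → ℝ) (n : ℕ) (s t : Site p) :
    interaction ν γ n (lift s) (lift t) = interaction ν (Fin.init γ) n s t := by
  rw [interaction, interaction, phase_lift]

lemma ignoresFinal_interaction (ν : Measure ℝ) (γ : Fin (p + 1) → ℝ) (n : ℕ) :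
    IgnoresFinal (interaction ν γ n) := by
  intro c x y z
  funext t
  have := ignoresFinal_phase γ t c x y z
  simp only [interaction, this]

lemma ignoresFinal_interaction_apply (ν : Measure ℝ) (γ : Fin (p + 1) → ℝ) (n : ℕ)
    (s : Site (p + 1)) : IgnoresFinal (interaction ν γ n s) := by
  intro c x y z
  rw [interaction_comm, interaction_comm ν γ n s, ignoresFinal_interaction]

lemma ignoresFinal_fieldDeviation (ν : Measure ℝ) (γ : Fin (p + 1) → ℝ) (n : ℕ)
    (L : List (Site (p + 1))) : IgnoresFinal (fieldDeviation ν γ n L) := by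
  intro c x y z
  simp only [fieldDeviation, ignoresFinal_interaction_apply ν γ n _ c x y z]

lemma partitionFunction_interaction_replicate_append (ν : Measure ℝ) (γ β : Fin (p + 1) → ℝ)
    (n : ℕ) {f : Site (p + 1) → ℂ} (hf : IgnoresFinal f) (k m : ℕ) :
    partitionFunction (interaction ν γ n) (fun _ => 1)
        (List.replicate k (fun t => siteWeight β t * f t) ++ List.replicate m (siteWeight β)) =
      ∑ t : Fin k → Site p, (∏ i, f (lift (t i))) *
        marginal ν (Fin.init γ) (Fin.init β) n (List.ofFn t) m := by
  have hlift := partitionFunction_lift β (interaction_lift ν γ n) (ignoresFinal_interaction ν γ n)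
    (ignoresFinal_interaction_apply ν γ n)
    (List.replicate k f ++ List.replicate m fun _ => 1) (by
      intro g hg
      rcases List.mem_append.1 hg with hg | hg
      · rwa [List.eq_of_mem_replicate hg]
      · rw [List.eq_of_mem_replicate hg]
        exact fun _ _ _ _ => rfl) (fun _ => 1) fun _ _ _ _ => rfl
  simp only [List.map_append, List.map_replicate, mul_one] at hlift
  exact hlift.trans (partitionFunction_replicate_append _ (fun t => f (lift t)) _ _ _)

theorem marginal_succ (ν : Measure ℝ) (γ β : Fin (p + 1) → ℝ) (n : ℕ) (L : List (Site (p + 1)))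
    (m : ℕ) : marginal ν γ β n L m =
      (L.map (siteWeight β)).prod * pairProd (interaction ν γ n) L *
        ∑ k ∈ Finset.range (m + 1), expansionTerm ν γ β n L m k := by
  have hfield : (fun s => siteWeight β s * (L.map fun t => interaction ν γ n t s).prod) =
      siteWeight β + fun s => siteWeight β s * fieldDeviation ν γ n L s := by
    funext s
    simp only [fieldDeviation, Pi.add_apply]
    ring
  rw [marginal, partitionFunction_map_pinned_append, partitionFunction_mul_field,
    List.map_replicate, hfield, partitionFunction_replicate_add (interaction_comm ν γ n)]
  simp only [List.map_const', List.prod_replicate, one_pow, mul_one, expansionTerm,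
    partitionFunction_interaction_replicate_append ν γ β n (ignoresFinal_fieldDeviation ν γ n L)]

variable {ν : Measure ℝ} [IsProbabilityMeasure ν]

lemma marginal_zero (γ β : Fin 0 → ℝ) (n : ℕ) (L : List (Site 0)) (m : ℕ) :
    marginal ν γ β n L m = (L.map (siteWeight β)).prod := by
  have hinteraction : interaction ν γ n = fun _ _ => 1 := by
    funext s t
    simp [interaction, phase, Phi]
  have hsum : ∑ t : Site 0, siteWeight β t = 1 := by
    simp [siteWeight, Q]
  unfold marginal
  rw [hinteraction]
  induction L with
  | nil =>
    induction m with
    | zero => simp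
    | succ m ih =>
      simpa [List.replicate_succ, partitionFunction_cons, ← Finset.sum_mul, hsum] using ih
  | cons t L ih => simpa [partitionFunction_pinned_cons] using Or.inl ih

lemma norm_interaction_le (γ : Fin p → ℝ) (n : ℕ) (s t : Site p) :
    ‖interaction ν γ n s t‖ ≤ 1 := norm_charFun_le_one _

/-- An upper bound for `3 * phase γ s t ^ 2`, uniform in the histories `s` and `t`. -/
def phaseBound (γ : Fin p → ℝ) : ℝ := ∑ s : Site p, ∑ t : Site p, 3 * phase γ s t ^ 2

lemma phaseBound_nonneg (γ : Fin p → ℝ) : 0 ≤ phaseBound γ :=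
  Finset.sum_nonneg fun _ _ => Finset.sum_nonneg fun _ _ => by positivity

lemma phase_sq_le (γ : Fin p → ℝ) (s t : Site p) : 3 * phase γ s t ^ 2 ≤ phaseBound γ := by
  refine (Finset.single_le_sum (f := fun t => 3 * phase γ s t ^ 2)
    (fun _ _ => by positivity) (Finset.mem_univ t)).trans ?_
  exact Finset.single_le_sum (f := fun s => ∑ t : Site p, 3 * phase γ s t ^ 2)
    (fun _ _ => Finset.sum_nonneg fun _ _ => by positivity) (Finset.mem_univ s)

lemma norm_interaction_sub_one_le (hν : IsStandardized ν) (γ : Fin p → ℝ) (n : ℕ)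
    (s t : Site p) : ‖interaction ν γ n s t - 1‖ ≤ phaseBound γ / n := by
  refine (norm_charFun_sub_one_le hν.memLp hν.mean_eq_zero _).trans ?_
  rw [hν.integral_sq_eq_one, mul_one, div_pow, Real.sq_sqrt (Nat.cast_nonneg n), ← mul_div_assoc]
  exact div_le_div_of_nonneg_right (phase_sq_le γ s t) (Nat.cast_nonneg n)

lemma tendsto_interaction (hν : IsStandardized ν) (γ : Fin p → ℝ) (s t : Site p) :
    Tendsto (fun n => interaction ν γ n s t) atTop (𝓝 1) := by
  rw [tendsto_iff_norm_sub_tendsto_zero]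
  exact squeeze_zero (fun _ => norm_nonneg _)
    (fun n => norm_interaction_sub_one_le hν γ n s t) (tendsto_const_div_atTop_nhds_zero_nat _)

lemma norm_fieldDeviation_le (hν : IsStandardized ν) (γ : Fin p → ℝ) (n : ℕ)
    (L : List (Site p)) (s : Site p) :
    ‖fieldDeviation ν γ n L s‖ ≤ L.length * (phaseBound γ / n) :=
  norm_list_prod_map_sub_one_le (fun t => norm_interaction_le γ n t s)
    (fun t => norm_interaction_sub_one_le hν γ n t s) L

lemma tendsto_fieldDeviation (hν : IsStandardized ν) (γ : Fin p → ℝ) (L : List (Site p))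
    (s : Site p) :
    Tendsto (fun n : ℕ => (n : ℂ) * fieldDeviation ν γ n L s) atTop
      (𝓝 (L.map fun t => -(phase γ t s : ℂ) ^ 2 / 2).sum) :=
  tendsto_mul_list_prod_map_sub_one (fun t => tendsto_interaction hν γ t s)
    (fun _ => tendsto_natCast_mul_charFun_sub_one hν.mean_eq_zero hν.integral_sq_eq_one _) L

-- The factor `n ^ (-k)` from the deviations beats the number of choices of `k` sites.
lemma norm_expansionTerm_le (hν : IsStandardized ν) (γ β : Fin (p + 1) → ℝ) {B : ℝ}
    (hB : ∀ n L m, 0 < n → m ≤ n →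
      ‖marginal ν (Fin.init γ) (Fin.init β) n L m‖ ≤ B ^ L.length)
    {n : ℕ} (L : List (Site (p + 1))) {m : ℕ} (k : ℕ) (hn : 0 < n) (hm : m ≤ n) :
    ‖expansionTerm ν γ β n L m k‖ ≤
      (L.length * (Fintype.card (Site p) * phaseBound γ * B)) ^ k / k.factorial := by
  have hγ := phaseBound_nonneg γ
  have hsummand (t : Fin k → Site p) :
      ‖(∏ i, fieldDeviation ν γ n L (lift (t i))) *
        marginal ν (Fin.init γ) (Fin.init β) n (List.ofFn t) (m - k)‖ ≤
      (L.length * (phaseBound γ / n)) ^ k * B ^ k := by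
    have hprod := Finset.prod_le_prod (s := Finset.univ) (fun _ _ => norm_nonneg _)
      fun i _ => norm_fieldDeviation_le hν γ n L (lift (t i))
    rw [Finset.prod_const, Finset.card_univ, Fintype.card_fin] at hprod
    have hmarginal := hB n (List.ofFn t) (m - k) hn (by omega)
    rw [List.length_ofFn] at hmarginal
    rw [norm_mul, norm_prod]
    exact mul_le_mul hprod hmarginal (norm_nonneg _) (by positivity)
  have hchoose : (m.choose k : ℝ) ≤ (n : ℝ) ^ k / k.factorial :=
    (Nat.choose_le_pow_div k m).trans (by gcongr)
  have hcancel : (n : ℝ) ^ k * (phaseBound γ / n) ^ k = phaseBound γ ^ k := by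
    rw [← mul_pow, mul_div_cancel₀ _ (by exact_mod_cast hn.ne')]
  rw [expansionTerm, norm_mul, Complex.norm_natCast]
  refine (mul_le_mul hchoose (norm_sum_le_of_le _ fun t _ => hsummand t) (norm_nonneg _)
    (by positivity)).trans_eq ?_
  rw [Finset.sum_const, Finset.card_univ, Fintype.card_fun, Fintype.card_fin, nsmul_eq_mul,
    mul_pow, mul_pow, mul_pow, mul_pow, ← hcancel]
  push_cast
  ring

theorem exists_norm_marginal_le (hν : IsStandardized ν) (γ β : Fin p → ℝ) :
    ∃ B : ℝ, 0 ≤ B ∧ ∀ n L m, 0 < n → m ≤ n → ‖marginal ν γ β n L m‖ ≤ B ^ L.length := by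
  induction p with
  | zero =>
    refine ⟨1, zero_le_one, fun n L m _ _ => ?_⟩
    rw [marginal_zero]
    refine norm_list_prod_map_le zero_le_one (fun t => ?_) L
    norm_num [siteWeight, Q]
  | succ p ih =>
    obtain ⟨B, hB₀, hB⟩ := ih (Fin.init γ) (Fin.init β)
    have hγ := phaseBound_nonneg γ
    set A : ℝ := ∑ t, ‖siteWeight β t‖
    have hA : ∀ t, ‖siteWeight β t‖ ≤ A := fun t =>
      Finset.single_le_sum (f := fun t => ‖siteWeight β t‖) (fun _ _ => norm_nonneg _)
        (Finset.mem_univ t)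
    have hA₀ : 0 ≤ A := Finset.sum_nonneg fun _ _ => norm_nonneg _
    refine ⟨A * Real.exp (Fintype.card (Site p) * phaseBound γ * B), by positivity,
      fun n L m hn hm => ?_⟩
    have hpairs := norm_pairProd_le_one (norm_interaction_le (ν := ν) γ n) L
    rw [marginal_succ, norm_mul, norm_mul, mul_pow, ← Real.exp_nat_mul]
    refine mul_le_mul ((mul_le_of_le_one_right (norm_nonneg _) hpairs).trans
      (norm_list_prod_map_le hA₀ hA L)) ?_ (norm_nonneg _) (by positivity)
    refine (norm_sum_le_of_le _ fun k _ => norm_expansionTerm_le hν γ β hB L k hn hm).trans ?_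
    exact Real.sum_le_exp_of_nonneg (by positivity) _

lemma tendsto_expansionTerm (hν : IsStandardized ν) {γ β : Fin (p + 1) → ℝ}
    {v : Config p → ℂ} (L : List (Site (p + 1))) (d k : ℕ)
    (hv : ∀ t : Fin k → Site p, Tendsto
      (fun n => marginal ν (Fin.init γ) (Fin.init β) n (List.ofFn t) (n - (d + k))) atTop
      (𝓝 (∏ i, v (t i).1 / 2))) :
    Tendsto (fun n => expansionTerm ν γ β n L (n - d) k) atTop
      (𝓝 ((∑ t : Site p, (L.map fun s => -(phase γ s (lift t) : ℂ) ^ 2 / 2).sum * (v t.1 / 2)) ^ k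
        / k.factorial)) := by
  have hchoose : Tendsto (fun n : ℕ => (((n - d).choose k : ℝ) / n ^ k : ℂ)) atTop
      (𝓝 (1 / k.factorial)) := by
    have := (Complex.continuous_ofReal.tendsto _).comp (tendsto_choose_div_pow d k)
    simpa [Function.comp_def] using this
  have hsummand (t : Fin k → Site p) := (tendsto_finsetProd Finset.univ fun i _ =>
    tendsto_fieldDeviation hν γ L (lift (t i))).mul (hv t)
  have hscaled := hchoose.mul (tendsto_finsetSum Finset.univ fun t _ => hsummand t)
  simp only [← Finset.prod_mul_distrib] at hscaled
  rw [Fintype.sum_pow, ← one_div_mul_eq_div]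
  refine hscaled.congr' ?_
  filter_upwards [eventually_gt_atTop 0] with n hn
  have hn₀ : (n : ℂ) ^ k ≠ 0 := pow_ne_zero _ (by exact_mod_cast hn.ne')
  simp only [expansionTerm, Finset.prod_mul_distrib, Finset.prod_const, Finset.card_univ,
    Fintype.card_fin, mul_assoc, Nat.sub_sub, ← Finset.mul_sum]
  push_cast
  field_simp

lemma tendsto_sum_expansionTerm (hν : IsStandardized ν) {γ β : Fin (p + 1) → ℝ}
    (L : List (Site (p + 1))) (d : ℕ) {x : ℂ}
    (hx : ∀ k : ℕ, Tendsto (fun n => expansionTerm ν γ β n L (n - d) k) atTop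
      (𝓝 (x ^ k / k.factorial))) :
    Tendsto (fun n => ∑ k ∈ Finset.range (n - d + 1), expansionTerm ν γ β n L (n - d) k) atTop
      (𝓝 (Complex.exp x)) := by
  obtain ⟨B, -, hB⟩ := exists_norm_marginal_le hν (Fin.init γ) (Fin.init β)
  rw [Complex.exp_eq_exp_ℂ, NormedSpace.exp_eq_tsum_div]
  refine (tendsto_tsum_of_dominated_convergence (Real.summable_pow_div_factorial
    (L.length * (Fintype.card (Site p) * phaseBound γ * B))) hx ?_).congr
    fun n => tsum_eq_sum fun k hk => ?_
  · filter_upwards [eventually_gt_atTop 0] with n hn k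
    exact norm_expansionTerm_le hν γ β hB L k hn (Nat.sub_le _ _)
  · rw [expansionTerm, Nat.choose_eq_zero_of_lt (by simpa using hk), Nat.cast_zero, zero_mul]

lemma phase_lift_right_sq (γ : Fin (p + 1) → ℝ) (s : Site (p + 1)) (c : Config p) (z : ℤˣ) :
    phase γ s (lift (c, z)) ^ 2 = Phi γ (extend c 1 1 * s.1) ^ 2 := by
  rw [phase, lift, Phi_mul_comm, mul_pow, mul_pow, sgn_sq, sgn_sq, one_mul, one_mul]

lemma sum_phase_sq_mul_reduce {γ β : Fin (p + 1) → ℝ} {w : Config (p + 1) → ℂ}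
    (hw : IsMeanField γ β w) (L : List (Site (p + 1))) :
    ∑ t : Site p, (L.map fun s => -(phase γ s (lift t) : ℂ) ^ 2 / 2).sum *
        (reduce w t.1 / 2) =
      (L.map fun s => -(1 / 2) * quadraticField γ w s.1).sum := by
  rw [sum_list_sum_mul]
  congr 1
  refine List.map_congr_left fun s _ => ?_
  rw [sum_site, hw.quadraticField_eq, Finset.mul_sum]
  refine Finset.sum_congr rfl fun c _ => ?_
  simp only [sum_units_int, ← Complex.ofReal_pow, phase_lift_right_sq]
  ring

lemma IsMeanField.prod_map_div_two {γ β : Fin p → ℝ} {w : Config p → ℂ}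
    (hw : IsMeanField γ β w) (L : List (Site p)) :
    (L.map fun t => w t.1 / 2).prod = (L.map (siteWeight β)).prod *
      Complex.exp (L.map fun s => -(1 / 2) * quadraticField γ w s.1).sum := by
  rw [Complex.exp_list_sum, List.map_map, ← List.prod_map_mul]
  congr 1
  refine List.map_congr_left fun s _ => ?_
  rw [hw.eq_Q_mul_exp, siteWeight, Function.comp]
  ring

theorem tendsto_marginal (hν : IsStandardized ν) {γ β : Fin p → ℝ} {w : Config p → ℂ}
    (hw : IsMeanField γ β w) (L : List (Site p)) (d : ℕ) :
    Tendsto (fun n => marginal ν γ β n L (n - d)) atTop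
      (𝓝 (L.map fun t => w t.1 / 2).prod) := by
  rw [hw.prod_map_div_two]
  induction p generalizing d with
  | zero =>
    simp [marginal_zero, quadraticField, Phi]
  | succ p ih =>
    rw [← sum_phase_sq_mul_reduce hw]
    have hterm (k : ℕ) := tendsto_expansionTerm hν (γ := γ) (β := β) L d k fun t => by
      have := ih hw.reduce (List.ofFn t) (d + k)
      rwa [← hw.reduce.prod_map_div_two, List.map_ofFn, List.prod_ofFn] at this
    have hpairs := tendsto_pairProd (tendsto_interaction hν γ) L
    rw [pairProd_one] at hpairs
    simpa only [marginal_succ, mul_one] using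
      (hpairs.const_mul (L.map (siteWeight β)).prod).mul (tendsto_sum_expansionTerm hν L d hterm)

end Marginals

/-! ## The output distribution as a sum over histories -/

section MatrixExponential

variable {ι : Type*} [Fintype ι] [DecidableEq ι]

lemma hasDerivAt_exp_smul_apply (A : Matrix ι ι ℂ) (b : ℝ) (i j : ι) :
    HasDerivAt (fun b : ℝ => NormedSpace.exp (b • A) i j)
      ((NormedSpace.exp (b • A) * A) i j) b := by
  let _ : NormedRing (Matrix ι ι ℂ) := Matrix.linftyOpNormedRing
  let _ : NormedAlgebra ℝ (Matrix ι ι ℂ) := Matrix.linftyOpNormedAlgebra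
  exact (LinearMap.toContinuousLinearMap (Matrix.entryLinearMap ℝ ℂ i j)).hasFDerivAt
    |>.comp_hasDerivAt b (hasDerivAt_exp_smul_const (𝕂 := ℝ) A b)

lemma exp_neg_mul_exp (A : Matrix ι ι ℂ) : NormedSpace.exp (-A) * NormedSpace.exp A = 1 := by
  rw [Matrix.exp_neg, Matrix.nonsing_inv_mul]
  exact (Matrix.isUnit_iff_isUnit_det _).1 (Matrix.isUnit_exp _)

lemma exp_neg_smul_eq {A : Matrix ι ι ℂ} {K : ℝ → Matrix ι ι ℂ} (hK₀ : K 0 = 1)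
    (hK : ∀ b i j, HasDerivAt (fun b => K b i j) ((-(A * K b)) i j) b) (b : ℝ) :
    NormedSpace.exp (-(b • A)) = K b := by
  have hderiv (i j : ι) (b : ℝ) :
      HasDerivAt (fun b : ℝ => (NormedSpace.exp (b • A) * K b) i j) 0 b := by
    simp only [Matrix.mul_apply]
    refine (HasDerivAt.fun_sum fun k _ =>
      (hasDerivAt_exp_smul_apply A b i k).mul (hK b k j)).congr_deriv ?_
    rw [Finset.sum_add_distrib, ← Matrix.mul_apply, ← Matrix.mul_apply, Matrix.mul_neg,
      Matrix.neg_apply, Matrix.mul_assoc, add_neg_cancel]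
  have hconst : NormedSpace.exp (b • A) * K b = 1 := by
    ext i j
    rw [is_const_of_deriv_eq_zero (fun b => (hderiv i j b).differentiableAt)
      (fun b => (hderiv i j b).deriv) b 0, zero_smul, NormedSpace.exp_zero, one_mul, hK₀]
  rw [← mul_one (NormedSpace.exp _), ← hconst, ← mul_assoc, exp_neg_mul_exp, one_mul]

lemma conjTranspose_exp_mul_exp {A : Matrix ι ι ℂ} (hA : A.IsHermitian) (b : ℝ) :
    (NormedSpace.exp (-(Complex.I * (b : ℂ)) • A))ᴴ *
      NormedSpace.exp (-(Complex.I * (b : ℂ)) • A) = 1 := by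
  have hskew : (-(Complex.I * (b : ℂ)) • A)ᴴ = -(-(Complex.I * (b : ℂ)) • A) := by
    rw [Matrix.conjTranspose_smul, hA.eq, ← neg_smul]
    simp
  rw [← Matrix.exp_conjTranspose, hskew, exp_neg_mul_exp]

lemma star_mulVec_dotProduct_mulVec {U : Matrix ι ι ℂ} (hU : Uᴴ * U = 1) (ψ : ι → ℂ) :
    star (U *ᵥ ψ) ⬝ᵥ (U *ᵥ ψ) = star ψ ⬝ᵥ ψ := by
  rw [Matrix.star_mulVec, Matrix.dotProduct_mulVec, Matrix.vecMul_vecMul, hU, Matrix.vecMul_one]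

end MatrixExponential

section Circuit

variable {n p : ℕ}

/-- The matrix elements of `exp(-iβX)` on one qubit, in terms of the product of the signs. -/
def mixEntry (β : ℝ) (x : ℤˣ) : ℂ :=
  if x = 1 then (Real.cos β : ℂ) else -Complex.I * (Real.sin β : ℂ)

/-- The explicit form of `exp(-iβB)`. -/
def mixKernel (n : ℕ) (β : ℝ) : Op n :=
  Matrix.of fun z' z => ∏ j, mixEntry β (z' j * z j)

/-- The string `z` with its `j`-th sign flipped. -/
def flipSpin (z : Spins n) (j : Fin n) : Spins n := Function.update z j (-z j)

lemma hasDerivAt_mixEntry (β : ℝ) (x : ℤˣ) :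
    HasDerivAt (fun b => mixEntry b x) (-Complex.I * mixEntry β (-x)) β := by
  rcases Int.units_eq_one_or x with rfl | rfl
  · simp only [mixEntry, if_true, show (-1 : ℤˣ) ≠ 1 by decide, if_false]
    convert (Real.hasDerivAt_cos β).ofReal_comp using 1
    rw [← mul_assoc, neg_mul_neg, Complex.I_mul_I]
    push_cast
    ring
  · simp only [mixEntry, show (-1 : ℤˣ) ≠ 1 by decide, if_false, neg_neg, if_true]
    exact (Real.hasDerivAt_sin β).ofReal_comp.const_mul _

lemma flipSpin_flipSpin (z : Spins n) (j : Fin n) : flipSpin (flipSpin z j) j = z := by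
  simp [flipSpin]

lemma pauliX_apply (j : Fin n) (z' z : Spins n) :
    pauliX j z' z = if z = flipSpin z' j then 1 else 0 := by
  have : (z' = flipSpin z j) ↔ z = flipSpin z' j :=
    ⟨fun h => by rw [h, flipSpin_flipSpin], fun h => by rw [h, flipSpin_flipSpin]⟩
  simp only [pauliX, Matrix.of_apply]
  exact if_congr this rfl rfl

lemma mixer_mul_apply (M : Op n) (z' z : Spins n) :
    (mixer n * M) z' z = ∑ j, M (flipSpin z' j) z := by
  simp only [Matrix.mul_apply, mixer, Matrix.sum_apply, Finset.sum_mul, pauliX_apply]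
  rw [Finset.sum_comm]
  simp

lemma mixKernel_flipSpin_apply (β : ℝ) (z' z : Spins n) (j : Fin n) :
    mixKernel n β (flipSpin z' j) z =
      (∏ k ∈ Finset.univ.erase j, mixEntry β (z' k * z k)) * mixEntry β (-(z' j * z j)) := by
  rw [mixKernel, Matrix.of_apply, ← Finset.prod_erase_mul Finset.univ _ (Finset.mem_univ j)]
  congr 1
  · refine Finset.prod_congr rfl fun k hk => ?_
    rw [flipSpin, Function.update_of_ne (Finset.ne_of_mem_erase hk)]
  · rw [flipSpin, Function.update_self, neg_mul]

lemma hasDerivAt_mixKernel_apply (β : ℝ) (z' z : Spins n) :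
    HasDerivAt (fun b => mixKernel n b z' z)
      ((-((Complex.I • mixer n) * mixKernel n β)) z' z) β := by
  refine (HasDerivAt.fun_finsetProd (u := Finset.univ) fun j _ =>
    hasDerivAt_mixEntry β (z' j * z j)).congr_deriv ?_
  rw [Matrix.neg_apply, Matrix.smul_mul, Matrix.smul_apply, mixer_mul_apply, smul_eq_mul,
    ← neg_mul, Finset.mul_sum]
  refine Finset.sum_congr rfl fun j _ => ?_
  rw [mixKernel_flipSpin_apply, smul_eq_mul, mul_left_comm]

lemma mixKernel_zero : mixKernel n 0 = 1 := by
  ext z' z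
  rw [mixKernel, Matrix.of_apply, Matrix.one_apply]
  split_ifs with hz
  · simp [hz, mixEntry, Int.units_mul_self]
  · obtain ⟨j, hj⟩ := Function.ne_iff.1 hz
    refine Finset.prod_eq_zero (Finset.mem_univ j) ?_
    have : z' j * z j ≠ 1 := fun h => hj <| by
      rw [← mul_one (z' j), ← Int.units_mul_self (z j), ← mul_assoc, h, one_mul]
    simp [mixEntry, this]

lemma mixerUnitary_eq_mixKernel (β : ℝ) : mixerUnitary n β = mixKernel n β := by
  rw [← exp_neg_smul_eq mixKernel_zero hasDerivAt_mixKernel_apply, mixerUnitary, neg_smul,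
    mul_comm, mul_smul, Complex.coe_smul]

lemma mixKernel_mul_apply (β : ℝ) (z w : Spins n) :
    mixKernel n β z (z * w) = ∏ j, mixEntry β (w j) := by
  simp only [mixKernel, Matrix.of_apply, Pi.mul_apply, ← mul_assoc, Int.units_mul_self, one_mul]

lemma costUnitary_eq_diagonal (J : Couplings n) (γ : ℝ) :
    costUnitary J γ = Matrix.diagonal fun z => Complex.exp (-(Complex.I * γ) * cost J z) := by
  rw [costUnitary, costOp, ← Matrix.diagonal_smul, Matrix.exp_diagonal]
  congr 1
  funext z
  rw [Pi.coe_exp, ← Complex.exp_eq_exp_ℂ]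
  rfl

lemma qaoaState_succ (J : Couplings n) (γ β : Fin (p + 1) → ℝ) :
    qaoaState J γ β = mixerUnitary n (β (Fin.last p)) *ᵥ
      (costUnitary J (γ (Fin.last p)) *ᵥ qaoaState J (Fin.init γ) (Fin.init β)) := by
  unfold qaoaState
  rw [List.finRange_succ_last, List.foldl_append, List.foldl_map]
  rfl

/-- The cost function extended to real-valued spins. -/
def spinCost (J : Couplings n) (v : Fin n → ℝ) : ℝ :=
  (1 / √n) * ∑ e : Pairs n, J e * v e.1.1 * v e.1.2

lemma cost_eq_spinCost (J : Couplings n) (z : Spins n) :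
    cost J z = spinCost J fun j => sgn (z j) := rfl

/-- The phase `∑ r, γ r * C(z⁽ʳ⁾)` of a path of strings that ends in `z`. The path is encoded by
the sign changes `a j` of each qubit `j`, so that `z⁽ʳ⁾` has the signs `z j * starProd (a j) r`. -/
def pathPhase (J : Couplings n) (γ : Fin p → ℝ) (z : Spins n) (a : Fin n → Fin p → ℤˣ) : ℝ :=
  ∑ r, γ r * spinCost J fun j => sgn (z j) * starProd (a j) r

/-- Appends the sign changes `t.1` in an additional last layer to the sign changes `t.2`. -/
def snocEquiv (n p : ℕ) :
    Spins n × (Fin n → Fin p → ℤˣ) ≃ (Fin n → Fin (p + 1) → ℤˣ) where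
  toFun t j := Fin.snoc (α := fun _ => ℤˣ) (t.2 j) (t.1 j)
  invFun a := (fun j => a j (Fin.last p), fun j => Fin.init (a j))
  left_inv t := by simp
  right_inv a := by simp

lemma pathPhase_snocEquiv (J : Couplings n) (γ : Fin (p + 1) → ℝ) (z w : Spins n)
    (a : Fin n → Fin p → ℤˣ) :
    pathPhase J γ z (snocEquiv n p (w, a)) =
      pathPhase J (Fin.init γ) (z * w) a + γ (Fin.last p) * cost J (z * w) := by
  unfold pathPhase
  rw [Fin.sum_univ_castSucc]
  simp only [snocEquiv, Equiv.coe_fn_mk, starProd_snoc_castSucc, starProd_snoc_last,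
    cost_eq_spinCost, Pi.mul_apply, sgn_mul, Fin.init, mul_assoc, mul_comm (sgn (w _))]

lemma prod_mixEntry_snocEquiv (β : Fin (p + 1) → ℝ) (w : Spins n) (a : Fin n → Fin p → ℤˣ) :
    ∏ j, ∏ r, mixEntry (β r) (snocEquiv n p (w, a) j r) =
      (∏ j, ∏ r, mixEntry (Fin.init β r) (a j r)) * ∏ j, mixEntry (β (Fin.last p)) (w j) := by
  rw [← Finset.prod_mul_distrib]
  refine Finset.prod_congr rfl fun j _ => ?_
  rw [Fin.prod_univ_castSucc]
  simp only [snocEquiv, Equiv.coe_fn_mk, Fin.snoc_castSucc, Fin.snoc_last, Fin.init]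

theorem qaoaState_apply (J : Couplings n) (γ β : Fin p → ℝ) (z : Spins n) :
    qaoaState J γ β z = ((1 / √(2 ^ n) : ℝ) : ℂ) * ∑ a : Fin n → Fin p → ℤˣ,
      (∏ j, ∏ r, mixEntry (β r) (a j r)) *
        Complex.exp (-(Complex.I * (pathPhase J γ z a : ℝ))) := by
  induction p generalizing z with
  | zero => simp [qaoaState, uniformState, pathPhase]
  | succ p ih =>
    rw [qaoaState_succ, costUnitary_eq_diagonal, mixerUnitary_eq_mixKernel,
      ← (snocEquiv n p).sum_comp, Fintype.sum_prod_type, Matrix.mulVec, dotProduct,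
      ← Equiv.sum_comp (Equiv.mulLeft z)]
    simp only [Matrix.mulVec_diagonal, ih, Equiv.coe_mulLeft, mixKernel_mul_apply,
      Finset.mul_sum, pathPhase_snocEquiv, prod_mixEntry_snocEquiv]
    refine Finset.sum_congr rfl fun w _ => Finset.sum_congr rfl fun a _ => ?_
    push_cast
    rw [mul_add, neg_add, Complex.exp_add, ← mul_assoc Complex.I, ← neg_mul (Complex.I * _)]
    ring

lemma conj_mixEntry_mul (β : ℝ) (x y : ℤˣ) :
    starRingEnd ℂ (mixEntry β x) * mixEntry β y = mixFactor β x y := by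
  have hne : (-1 : ℤˣ) ≠ 1 := by decide
  rcases Int.units_eq_one_or x with rfl | rfl <;> rcases Int.units_eq_one_or y with rfl | rfl <;>
    simp only [mixEntry, mixFactor, theta_one, theta_neg_one, hne, if_true, if_false, neg_neg,
      map_mul, map_neg, Complex.conj_I, Complex.conj_ofReal] <;> norm_num
  · ring
  · ring
  · ring
  · linear_combination (-(Complex.sin β) ^ 2) * Complex.I_mul_I

lemma conj_prod_mixEntry_mul (β : Fin p → ℝ) (a b : Fin n → Fin p → ℤˣ) :
    starRingEnd ℂ (∏ j, ∏ r, mixEntry (β r) (a j r)) * (∏ j, ∏ r, mixEntry (β r) (b j r)) =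
      ∏ j, Q β (a j, b j) := by
  simp only [map_prod, ← Finset.prod_mul_distrib, conj_mixEntry_mul]
  rfl

lemma pathPhase_sub (J : Couplings n) (γ : Fin p → ℝ) (z : Spins n)
    (a b : Fin n → Fin p → ℤˣ) :
    pathPhase J γ z a - pathPhase J γ z b = ∑ e : Pairs n,
      phase γ ((a e.1.1, b e.1.1), z e.1.1) ((a e.1.2, b e.1.2), z e.1.2) / √n * J e := by
  unfold pathPhase phase Phi spinCost
  rw [← Finset.sum_sub_distrib]
  simp only [Finset.mul_sum, Finset.sum_mul, ← Finset.sum_sub_distrib, Finset.sum_div]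
  rw [Finset.sum_comm]
  refine Finset.sum_congr rfl fun e _ => Finset.sum_congr rfl fun r _ => ?_
  simp only [Prod.fst_mul, Prod.snd_mul, starProd_mul]
  ring

lemma conj_exp_pathPhase_mul (J : Couplings n) (γ : Fin p → ℝ) (z : Spins n)
    (a b : Fin n → Fin p → ℤˣ) :
    starRingEnd ℂ (Complex.exp (-(Complex.I * (pathPhase J γ z a : ℝ)))) *
        Complex.exp (-(Complex.I * (pathPhase J γ z b : ℝ))) =
      ∏ e : Pairs n, Complex.exp
        ((phase γ ((a e.1.1, b e.1.1), z e.1.1) ((a e.1.2, b e.1.2), z e.1.2) / √n : ℝ) * J e *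
          Complex.I) := by
  have hsub := congrArg Complex.ofReal (pathPhase_sub J γ z a b)
  push_cast at hsub
  rw [← Complex.exp_conj, ← Complex.exp_add, ← Complex.exp_sum, ← Finset.sum_mul]
  congr 1
  simp only [map_neg, map_mul, Complex.conj_I, Complex.conj_ofReal]
  push_cast
  rw [← hsub]
  ring

/-- The weight of the histories `s` of all qubits for fixed couplings: the product of the
amplitudes of two paths with the same final string, one of them conjugated. -/
def pathWeight (J : Couplings n) (γ β : Fin p → ℝ) (s : Fin n → Site p) : ℂ :=
  (∏ j, siteWeight β (s j)) *
    ∏ e : Pairs n, Complex.exp ((phase γ (s e.1.1) (s e.1.2) / √n : ℝ) * J e * Complex.I)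

lemma one_div_sqrt_two_pow_mul_self (n : ℕ) :
    ((1 / √(2 ^ n) : ℝ) : ℂ) * ((1 / √(2 ^ n) : ℝ) : ℂ) = 1 / 2 ^ n := by
  rw [← Complex.ofReal_mul, div_mul_div_comm, Real.mul_self_sqrt (by positivity)]
  simp

lemma normSq_qaoaState (J : Couplings n) (γ β : Fin p → ℝ) (z : Spins n) :
    ((‖qaoaState J γ β z‖ ^ 2 : ℝ) : ℂ) = ∑ a : Fin n → Fin p → ℤˣ, ∑ b : Fin n → Fin p → ℤˣ,
      pathWeight J γ β fun j => ((a j, b j), z j) := by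
  rw [Complex.ofReal_pow, ← Complex.conj_mul', qaoaState_apply, map_mul, map_sum,
    mul_mul_mul_comm, Finset.sum_mul_sum, Complex.conj_ofReal, Finset.mul_sum]
  refine Finset.sum_congr rfl fun a _ => ?_
  rw [Finset.mul_sum]
  refine Finset.sum_congr rfl fun b _ => ?_
  rw [map_mul, mul_mul_mul_comm (starRingEnd ℂ (∏ j, ∏ r, mixEntry (β r) (a j r))),
    one_div_sqrt_two_pow_mul_self, conj_prod_mixEntry_mul, conj_exp_pathPhase_mul, pathWeight]
  simp only [siteWeight, Finset.prod_div_distrib, Finset.prod_const, Finset.card_univ,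
    Fintype.card_fin]
  ring

theorem sum_mul_normSq_qaoaState (J : Couplings n) (γ β : Fin p → ℝ) (g : Spins n → ℝ) :
    ((∑ z, g z * ‖qaoaState J γ β z‖ ^ 2 : ℝ) : ℂ) =
      ∑ s : Fin n → Site p, (g (fun j => (s j).2) : ℂ) * pathWeight J γ β s := by
  rw [← (Equiv.arrowProdEquivProdArrow (Fin n) (fun _ => Config p) fun _ => ℤˣ).symm.sum_comp,
    Fintype.sum_prod_type, Finset.sum_comm, Complex.ofReal_sum]
  refine Finset.sum_congr rfl fun z _ => ?_
  rw [Complex.ofReal_mul, normSq_qaoaState,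
    ← (Equiv.arrowProdEquivProdArrow (Fin n) (fun _ => Fin p → ℤˣ)
      fun _ => Fin p → ℤˣ).symm.sum_comp, Fintype.sum_prod_type, Finset.mul_sum]
  refine Finset.sum_congr rfl fun a _ => ?_
  rw [Finset.mul_sum]
  rfl

lemma energyOp_pow (J : Couplings n) (k : ℕ) :
    energyOp J ^ k = Matrix.diagonal fun z => (((cost J z / n) ^ k : ℝ) : ℂ) := by
  rw [energyOp, costOp, ← Matrix.diagonal_smul, Matrix.diagonal_pow]
  congr 1
  funext z
  simp only [Pi.pow_apply, Pi.smul_apply, smul_eq_mul]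
  push_cast
  ring

lemma energyMoment_eq_sum (k : ℕ) (J : Couplings n) (γ β : Fin p → ℝ) :
    energyMoment k γ β J = ∑ z, (cost J z / n) ^ k * ‖qaoaState J γ β z‖ ^ 2 := by
  have hbraket : braket (qaoaState J γ β) (energyOp J ^ k) =
      ((∑ z, (cost J z / n) ^ k * ‖qaoaState J γ β z‖ ^ 2 : ℝ) : ℂ) := by
    rw [braket, energyOp_pow, dotProduct, Complex.ofReal_sum]
    refine Finset.sum_congr rfl fun z _ => ?_
    rw [Matrix.mulVec_diagonal, Complex.ofReal_mul _ (‖qaoaState J γ β z‖ ^ 2),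
      Complex.ofReal_pow ‖qaoaState J γ β z‖, ← Complex.conj_mul']
    simp only [Pi.star_apply, RCLike.star_def]
    ring
  rw [energyMoment, hbraket, Complex.ofReal_re]

lemma mixer_isHermitian (n : ℕ) : (mixer n).IsHermitian := by
  refine Matrix.IsHermitian.ext fun z z' => ?_
  simp only [mixer, Matrix.sum_apply, star_sum]
  refine Finset.sum_congr rfl fun j _ => ?_
  rw [pauliX_apply, pauliX, Matrix.of_apply]
  split_ifs <;> simp_all [flipSpin]

lemma costOp_isHermitian (J : Couplings n) : (costOp J).IsHermitian := by
  rw [costOp, Matrix.isHermitian_diagonal_iff]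
  intro z
  simp [isSelfAdjoint_iff]

lemma star_dotProduct_qaoaState (J : Couplings n) (γ β : Fin p → ℝ) :
    star (qaoaState J γ β) ⬝ᵥ qaoaState J γ β = 1 := by
  induction p with
  | zero =>
    simp only [qaoaState, List.finRange_zero, List.foldl_nil, dotProduct, Pi.star_apply,
      uniformState, RCLike.star_def, Complex.conj_ofReal, one_div_sqrt_two_pow_mul_self]
    simp
  | succ p ih =>
    have hmixer : (mixerUnitary n (β (Fin.last p)))ᴴ * mixerUnitary n (β (Fin.last p)) = 1 :=
      conjTranspose_exp_mul_exp (mixer_isHermitian n) _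
    have hcost : (costUnitary J (γ (Fin.last p)))ᴴ * costUnitary J (γ (Fin.last p)) = 1 :=
      conjTranspose_exp_mul_exp (costOp_isHermitian J) _
    rw [qaoaState_succ, star_mulVec_dotProduct_mulVec hmixer, star_mulVec_dotProduct_mulVec hcost,
      ih]

lemma sum_normSq_qaoaState (J : Couplings n) (γ β : Fin p → ℝ) :
    ∑ z, ‖qaoaState J γ β z‖ ^ 2 = 1 := by
  have hdot : star (qaoaState J γ β) ⬝ᵥ qaoaState J γ β =
      ((∑ z, ‖qaoaState J γ β z‖ ^ 2 : ℝ) : ℂ) := by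
    rw [dotProduct, Complex.ofReal_sum]
    exact Finset.sum_congr rfl fun z _ => by
      rw [Complex.ofReal_pow, ← Complex.conj_mul']; rfl
  rw [star_dotProduct_qaoaState] at hdot
  exact_mod_cast hdot.symm

end Circuit

/-! ## Averages over the couplings -/

section Pairs

variable {n : ℕ}

lemma prod_pairs {M : Type*} [CommMonoid M] (f : Fin n → Fin n → M) :
    ∏ e : Pairs n, f e.1.1 e.1.2 = ∏ i, ∏ j ∈ Finset.Ioi i, f i j := by
  rw [← Finset.prod_subtype (Finset.univ.filter fun e : Fin n × Fin n => e.1 < e.2)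
    (fun e => by simp) (fun e => f e.1 e.2), Finset.prod_filter, Fintype.prod_prod_type]
  refine Finset.prod_congr rfl fun i _ => ?_
  rw [← Finset.prod_filter]
  exact Finset.prod_congr (by ext; simp) fun _ _ => rfl

lemma card_pairs_mul_two (n : ℕ) : Fintype.card (Pairs n) * 2 = n * (n - 1) := by
  have hcard : Fintype.card (Pairs n) = ∑ i : Fin n, (n - 1 - i) := by
    have hprod := prod_pairs (n := n) (M := Multiplicative ℕ) fun _ _ => Multiplicative.ofAdd 1
    simpa [toAdd_prod] using congrArg Multiplicative.toAdd hprod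
  rw [hcard, Fin.sum_univ_eq_sum_range (fun i => n - 1 - i),
    Finset.sum_range_reflect (fun i => i), Finset.sum_range_id_mul_two]

lemma card_pairs_le (n : ℕ) : Fintype.card (Pairs n) ≤ n ^ 2 := by
  have hle : n * (n - 1) ≤ n * n := Nat.mul_le_mul_left _ (Nat.sub_le _ _)
  nlinarith [card_pairs_mul_two n]

lemma tendsto_card_pairs_div :
    Tendsto (fun n : ℕ => (Fintype.card (Pairs n) : ℝ) / n ^ 2) atTop (𝓝 (1 / 2)) := by
  refine ((tendsto_natCast_sub_div 1).div_const 2).congr' ?_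
  filter_upwards [eventually_gt_atTop 0] with n hn
  have hcard : (Fintype.card (Pairs n) : ℝ) * 2 = n * (n - 1 : ℕ) := by
    exact_mod_cast card_pairs_mul_two n
  have : (n : ℝ) ≠ 0 := by exact_mod_cast hn.ne'
  rw [div_div, div_eq_div_iff (by positivity) (by positivity)]
  linear_combination (-(n : ℝ)) * hcard

/-- Two pairs have a site in common. -/
def Meets (e e' : Pairs n) : Prop :=
  e.1.1 = e'.1.1 ∨ e.1.1 = e'.1.2 ∨ e.1.2 = e'.1.1 ∨ e.1.2 = e'.1.2

instance (e e' : Pairs n) : Decidable (Meets e e') := by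
  unfold Meets
  infer_instance

lemma card_filter_eq_fst_le (v : Fin n) :
    (Finset.univ.filter fun e : Pairs n => v = e.1.1).card ≤ n := by
  simpa using Finset.card_le_card_of_injOn (t := (Finset.univ : Finset (Fin n)))
    (fun e : Pairs n => e.1.2) (fun _ _ => Finset.mem_univ _)
    fun e he e' he' h => Subtype.ext (Prod.ext (by simp_all) h)

lemma card_filter_eq_snd_le (v : Fin n) :
    (Finset.univ.filter fun e : Pairs n => v = e.1.2).card ≤ n := by
  simpa using Finset.card_le_card_of_injOn (t := (Finset.univ : Finset (Fin n)))
    (fun e : Pairs n => e.1.1) (fun _ _ => Finset.mem_univ _)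
    fun e he e' he' h => Subtype.ext (Prod.ext h (by simp_all))

lemma card_filter_meets_le (e : Pairs n) :
    (Finset.univ.filter fun e' => Meets e e').card ≤ 4 * n := by
  simp only [Meets, Finset.filter_or]
  calc _ ≤ n + (n + (n + n)) :=
        (Finset.card_union_le _ _).trans <| add_le_add (card_filter_eq_fst_le _) <|
          (Finset.card_union_le _ _).trans <| add_le_add (card_filter_eq_snd_le _) <|
            (Finset.card_union_le _ _).trans <|
              add_le_add (card_filter_eq_fst_le _) (card_filter_eq_snd_le _)
    _ = 4 * n := by ring

end Pairs

section Averages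

variable {n p : ℕ} {ν : Measure ℝ} [IsProbabilityMeasure ν]

instance : IsProbabilityMeasure (instanceLaw ν n) :=
  inferInstanceAs (IsProbabilityMeasure (Measure.pi fun _ => ν))

lemma monomial_mul_pathWeight (γ β : Fin p → ℝ) (m : Pairs n → ℕ) (s : Fin n → Site p)
    (J : Couplings n) :
    (∏ e, (J e : ℂ) ^ m e) * pathWeight J γ β s = (∏ j, siteWeight β (s j)) *
      ∏ e : Pairs n, ((J e : ℂ) ^ m e * Complex.exp
        ((phase γ (s e.1.1) (s e.1.2) / √n : ℝ) * J e * Complex.I)) := by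
  rw [Finset.prod_mul_distrib, pathWeight]
  ring

lemma integrable_monomial_mul_pathWeight {k : ℕ} (hν : MemLp id k ν) (γ β : Fin p → ℝ)
    {m : Pairs n → ℕ} (hm : ∀ e, m e ≤ k) (s : Fin n → Site p) :
    Integrable (fun J : Couplings n => (∏ e, (J e : ℂ) ^ m e) * pathWeight J γ β s)
      (instanceLaw ν n) := by
  simp only [monomial_mul_pathWeight]
  exact (Integrable.fintype_prod (f := fun (e : Pairs n) (x : ℝ) => (x : ℂ) ^ m e *
    Complex.exp ((phase γ (s e.1.1) (s e.1.2) / √n : ℝ) * x * Complex.I))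
    fun e => integrable_pow_mul_exp hν (hm e) _).const_mul _

lemma integral_monomial_mul_pathWeight (γ β : Fin p → ℝ) (m : Pairs n → ℕ)
    (s : Fin n → Site p) :
    ∫ J : Couplings n, (∏ e, (J e : ℂ) ^ m e) * pathWeight J γ β s ∂(instanceLaw ν n) =
      (∏ j, siteWeight β (s j)) *
        ∏ e : Pairs n, fourierMoment ν (m e) (phase γ (s e.1.1) (s e.1.2) / √n) := by
  simp only [monomial_mul_pathWeight]
  rw [integral_const_mul]
  congr 1
  exact integral_fintype_prod_eq_prod (fun (e : Pairs n) (x : ℝ) => (x : ℂ) ^ m e *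
    Complex.exp ((phase γ (s e.1.1) (s e.1.2) / √n : ℝ) * x * Complex.I))

/-- How often each pair occurs in a family of pairs. -/
def occurrences {k : ℕ} (ε : Fin k → Pairs n) (e : Pairs n) : ℕ :=
  (Finset.univ.filter fun i => ε i = e).card

lemma occurrences_le {k : ℕ} (ε : Fin k → Pairs n) (e : Pairs n) : occurrences ε e ≤ k :=
  (Finset.card_filter_le _ _).trans (by simp)

lemma prod_pow_occurrences {M : Type*} [CommMonoid M] {k : ℕ} (ε : Fin k → Pairs n)
    (J : Pairs n → M) : ∏ i, J (ε i) = ∏ e, J e ^ occurrences ε e := by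
  rw [← Finset.prod_fiberwise' Finset.univ ε J]
  simp [occurrences]

/-- The product of the final spins of two sites, by which their coupling enters the cost
function. -/
def pairSign (s t : Site p) : ℂ := sgn s.2 * sgn t.2

lemma ofReal_energyMoment_eq_sum_pathWeight (γ β : Fin p → ℝ) (k : ℕ) (J : Couplings n) :
    (energyMoment k γ β J : ℂ) = ((n * √n : ℝ) : ℂ)⁻¹ ^ k * ∑ ε : Fin k → Pairs n,
      ∑ s : Fin n → Site p, (∏ i, pairSign (s (ε i).1.1) (s (ε i).1.2)) *
        ((∏ e, (J e : ℂ) ^ occurrences ε e) * pathWeight J γ β s) := by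
  rw [energyMoment_eq_sum, sum_mul_normSq_qaoaState, Finset.sum_comm, Finset.mul_sum]
  refine Finset.sum_congr rfl fun s _ => ?_
  have hcost : ((cost J fun j => (s j).2) / n : ℝ) = (n * √n)⁻¹ *
      ∑ e : Pairs n, J e * sgn (s e.1.1).2 * sgn (s e.1.2).2 := by
    rw [cost, mul_inv]
    ring
  rw [hcost, mul_pow, Fintype.sum_pow]
  push_cast
  rw [mul_assoc, Finset.sum_mul]
  congr 1
  refine Finset.sum_congr rfl fun ε _ => ?_
  rw [← prod_pow_occurrences ε fun e => (J e : ℂ), ← mul_assoc, ← Finset.prod_mul_distrib]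
  congr 1
  refine Finset.prod_congr rfl fun i _ => ?_
  rw [pairSign]
  ring

lemma integrable_ofReal_energyMoment {k : ℕ} (hν : MemLp id k ν) (γ β : Fin p → ℝ) :
    Integrable (fun J : Couplings n => (energyMoment k γ β J : ℂ)) (instanceLaw ν n) := by
  simp only [ofReal_energyMoment_eq_sum_pathWeight]
  exact (integrable_finsetSum _ fun ε _ => integrable_finsetSum _ fun s _ =>
    (integrable_monomial_mul_pathWeight hν γ β (occurrences_le ε) s).const_mul _).const_mul _

lemma integrable_energyMoment {k : ℕ} (hν : MemLp id k ν) (γ β : Fin p → ℝ) :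
    Integrable (fun J : Couplings n => energyMoment k γ β J) (instanceLaw ν n) := by
  simpa using (integrable_ofReal_energyMoment (n := n) hν γ β).re

/-- The sum over all histories of the `J`-average of a product of terms of the cost function,
one for each member of the family `ε`. -/
def pairAverage (ν : Measure ℝ) (γ β : Fin p → ℝ) {k : ℕ} (ε : Fin k → Pairs n) : ℂ :=
  ∑ s : Fin n → Site p, (∏ i, pairSign (s (ε i).1.1) (s (ε i).1.2)) *
    ((∏ j, siteWeight β (s j)) *
      ∏ e : Pairs n, fourierMoment ν (occurrences ε e) (phase γ (s e.1.1) (s e.1.2) / √n))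

lemma integral_energyMoment {k : ℕ} (hν : MemLp id k ν) (γ β : Fin p → ℝ) :
    ((∫ J : Couplings n, energyMoment k γ β J ∂(instanceLaw ν n) : ℝ) : ℂ) =
      ((n * √n : ℝ) : ℂ)⁻¹ ^ k * ∑ ε : Fin k → Pairs n, pairAverage ν γ β ε := by
  have hint (ε : Fin k → Pairs n) (s : Fin n → Site p) : Integrable (fun J : Couplings n =>
      (∏ i, pairSign (s (ε i).1.1) (s (ε i).1.2)) *
        ((∏ e, (J e : ℂ) ^ occurrences ε e) * pathWeight J γ β s)) (instanceLaw ν n) :=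
    (integrable_monomial_mul_pathWeight hν γ β (occurrences_le ε) s).const_mul _
  rw [← integral_complex_ofReal]
  simp only [ofReal_energyMoment_eq_sum_pathWeight]
  rw [integral_const_mul,
    integral_finsetSum _ fun ε _ => integrable_finsetSum _ fun s _ => hint ε s]
  congr 1
  refine Finset.sum_congr rfl fun ε _ => ?_
  rw [integral_finsetSum _ fun s _ => hint ε s, pairAverage]
  refine Finset.sum_congr rfl fun s _ => ?_
  rw [integral_const_mul, integral_monomial_mul_pathWeight]

end Averages

/-! ## Insertions of terms of the cost function -/

section Insertions

variable {n p : ℕ} {ν : Measure ℝ}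

/-- The factor by which the insertion of the `k`-th power of a coupling changes the interaction
of its sites. -/
def momentRatio (ν : Measure ℝ) (γ : Fin p → ℝ) (n k : ℕ) (s t : Site p) : ℂ :=
  fourierMoment ν k (phase γ s t / √n) / interaction ν γ n s t

/-- The factor that the insertion of one term of the cost function contributes. -/
def edgeTerm (ν : Measure ℝ) (γ : Fin p → ℝ) (n : ℕ) (s t : Site p) : ℂ :=
  pairSign s t * momentRatio ν γ n 1 s t

lemma momentRatio_zero {γ : Fin p → ℝ} {s t : Site p} (hne : interaction ν γ n s t ≠ 0) :
    momentRatio ν γ n 0 s t = 1 := by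
  rw [momentRatio, fourierMoment_zero]
  exact div_self hne

lemma occurrences_eq_zero {k : ℕ} {ε : Fin k → Pairs n} {e : Pairs n} (he : e ∉ Set.range ε) :
    occurrences ε e = 0 := by
  rw [occurrences, Finset.card_eq_zero, Finset.filter_eq_empty_iff]
  exact fun i _ hi => he ⟨i, hi⟩

lemma occurrences_apply {k : ℕ} {ε : Fin k → Pairs n} (hε : Function.Injective ε) (i : Fin k) :
    occurrences ε (ε i) = 1 := by
  simp [occurrences, hε.eq_iff, Finset.filter_eq']

lemma occurrences_const_self (k : ℕ) (e : Pairs n) : occurrences (fun _ : Fin k => e) e = k := by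
  simp [occurrences]

lemma pairAverage_eq_sum {γ : Fin p → ℝ} (hne : ∀ s t : Site p, interaction ν γ n s t ≠ 0)
    (β : Fin p → ℝ) {k : ℕ} (ε : Fin k → Pairs n) :
    pairAverage ν γ β ε = ∑ s : Fin n → Site p,
      (∏ i, pairSign (s (ε i).1.1) (s (ε i).1.2)) *
        (∏ e : Pairs n, momentRatio ν γ n (occurrences ε e) (s e.1.1) (s e.1.2)) *
          gibbsWeight (interaction ν γ n) (siteWeight β) s := by
  refine Finset.sum_congr rfl fun s _ => ?_
  rw [gibbsWeight, ← prod_pairs fun i j => interaction ν γ n (s i) (s j), mul_assoc,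
    mul_left_comm (∏ e : Pairs n, _), ← Finset.prod_mul_distrib]
  simp only [momentRatio, div_mul_cancel₀ _ (hne _ _)]

lemma pairAverage_of_injective {γ : Fin p → ℝ}
    (hne : ∀ s t : Site p, interaction ν γ n s t ≠ 0) (β : Fin p → ℝ) {k : ℕ}
    {ε : Fin k → Pairs n} (hε : Function.Injective ε) :
    pairAverage ν γ β ε = ∑ s : Fin n → Site p,
      (∏ i, edgeTerm ν γ n (s (ε i).1.1) (s (ε i).1.2)) *
        gibbsWeight (interaction ν γ n) (siteWeight β) s := by
  rw [pairAverage_eq_sum hne]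
  refine Finset.sum_congr rfl fun s _ => ?_
  simp only [edgeTerm, Finset.prod_mul_distrib]
  rw [← Fintype.prod_of_injective ε hε
    (fun i => momentRatio ν γ n 1 (s (ε i).1.1) (s (ε i).1.2))]
  · intro e he
    rw [occurrences_eq_zero he, momentRatio_zero (hne _ _)]
  · intro i
    rw [occurrences_apply hε]

lemma pairAverage_const {γ : Fin p → ℝ} (hne : ∀ s t : Site p, interaction ν γ n s t ≠ 0)
    (β : Fin p → ℝ) (k : ℕ) (e : Pairs n) :
    pairAverage ν γ β (fun _ : Fin k => e) = ∑ s : Fin n → Site p,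
      pairSign (s e.1.1) (s e.1.2) ^ k * momentRatio ν γ n k (s e.1.1) (s e.1.2) *
        gibbsWeight (interaction ν γ n) (siteWeight β) s := by
  rw [pairAverage_eq_sum hne]
  refine Finset.sum_congr rfl fun s _ => ?_
  rw [Fin.prod_const, Fintype.prod_eq_single e, occurrences_const_self]
  intro e' he'
  rw [occurrences_eq_zero, momentRatio_zero (hne _ _)]
  exact fun ⟨_, h⟩ => he' h.symm

/-- The average of one term of the cost function. -/
def onePairSum (ν : Measure ℝ) (γ β : Fin p → ℝ) (n : ℕ) : ℂ :=
  ∑ t : Fin 2 → Site p, edgeTerm ν γ n (t 0) (t 1) * marginal ν γ β n (List.ofFn t) (n - 2)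

/-- The average of the product of two terms of the cost function that share no site. -/
def twoPairSum (ν : Measure ℝ) (γ β : Fin p → ℝ) (n : ℕ) : ℂ :=
  ∑ t : Fin 4 → Site p, edgeTerm ν γ n (t 0) (t 1) * edgeTerm ν γ n (t 2) (t 3) *
    marginal ν γ β n (List.ofFn t) (n - 4)

/-- The four end points of two pairs. -/
def endpoints (ε : Fin 2 → Pairs n) : Fin 4 → Fin n :=
  ![(ε 0).1.1, (ε 0).1.2, (ε 1).1.1, (ε 1).1.2]

lemma endpoints_injective {ε : Fin 2 → Pairs n} (hε : ¬ Meets (ε 0) (ε 1)) :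
    Function.Injective (endpoints ε) := by
  obtain ⟨_, _, _, _⟩ : _ ∧ _ ∧ _ ∧ _ := by simpa only [Meets, not_or] using hε
  have := (ε 0).2.ne
  have := (ε 1).2.ne
  intro i j
  fin_cases i <;> fin_cases j <;> simp_all [endpoints, eq_comm]

lemma injective_of_ne {ε : Fin 2 → Pairs n} (hε : ε 0 ≠ ε 1) : Function.Injective ε := by
  intro i j
  fin_cases i <;> fin_cases j <;> simp [hε, hε.symm]

lemma pairAverage_eq_onePairSum {γ : Fin p → ℝ}
    (hne : ∀ s t : Site p, interaction ν γ n s t ≠ 0) (β : Fin p → ℝ) (ε : Fin 1 → Pairs n) :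
    pairAverage ν γ β ε = onePairSum ν γ β n := by
  have hinj : Function.Injective ![(ε 0).1.1, (ε 0).1.2] := by
    have := (ε 0).2.ne
    intro i j
    fin_cases i <;> fin_cases j <;> simp [this, this.symm]
  rw [pairAverage_of_injective hne β (Function.injective_of_subsingleton ε)]
  simpa [onePairSum, marginal] using sum_comp_mul_gibbsWeight (interaction_comm ν γ n)
    (siteWeight β) hinj fun t => edgeTerm ν γ n (t 0) (t 1)

lemma twoPairSum_eq_sum (γ β : Fin p → ℝ) {i : Fin 4 → Fin n} (hi : Function.Injective i) :
    twoPairSum ν γ β n = ∑ s : Fin n → Site p,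
      edgeTerm ν γ n (s (i 0)) (s (i 1)) * edgeTerm ν γ n (s (i 2)) (s (i 3)) *
        gibbsWeight (interaction ν γ n) (siteWeight β) s :=
  (sum_comp_mul_gibbsWeight (interaction_comm ν γ n) (siteWeight β) hi
    fun t => edgeTerm ν γ n (t 0) (t 1) * edgeTerm ν γ n (t 2) (t 3)).symm

lemma pairAverage_eq_twoPairSum {γ : Fin p → ℝ}
    (hne : ∀ s t : Site p, interaction ν γ n s t ≠ 0) (β : Fin p → ℝ) {ε : Fin 2 → Pairs n}
    (hε : ¬ Meets (ε 0) (ε 1)) : pairAverage ν γ β ε = twoPairSum ν γ β n := by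
  have hdistinct : ε 0 ≠ ε 1 := fun h => hε (Or.inl (h ▸ rfl))
  rw [pairAverage_of_injective hne β (injective_of_ne hdistinct),
    twoPairSum_eq_sum γ β (endpoints_injective hε)]
  simp only [Fin.prod_univ_two]
  rfl

end Insertions

section Bounds

variable {n p : ℕ} {ν : Measure ℝ} {γ β : Fin p → ℝ}

/-- `C` bounds the averages of functions of the histories of `k` sites, not necessarily distinct,
in terms of the supremum of the function. -/
structure BoundsCorrelations (ν : Measure ℝ) (γ β : Fin p → ℝ) (n k : ℕ) (C : ℝ) : Prop where
  nonneg : 0 ≤ C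
  norm_sum_le : ∀ (i : Fin k → Fin n) (G : (Fin k → Site p) → ℂ) (g : ℝ), (∀ t, ‖G t‖ ≤ g) →
    ‖∑ s : Fin n → Site p, G (s ∘ i) * gibbsWeight (interaction ν γ n) (siteWeight β) s‖ ≤ g * C

lemma norm_sum_comp_mul_gibbsWeight_le {B : ℝ}
    (hB : ∀ L m, m ≤ n → ‖marginal ν γ β n L m‖ ≤ B ^ L.length) {k : ℕ} {i : Fin k → Fin n}
    (hi : Function.Injective i) {G : (Fin k → Site p) → ℂ} {g : ℝ} (hG : ∀ t, ‖G t‖ ≤ g) :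
    ‖∑ s : Fin n → Site p, G (s ∘ i) * gibbsWeight (interaction ν γ n) (siteWeight β) s‖ ≤
      g * (Fintype.card (Site p) * B) ^ k := by
  rw [sum_comp_mul_gibbsWeight (interaction_comm ν γ n) (siteWeight β) hi]
  calc _ ≤ ∑ _t : Fin k → Site p, g * B ^ k := norm_sum_le_of_le _ fun t _ => by
        have hmarginal := hB (List.ofFn t) (n - k) (Nat.sub_le _ _)
        rw [List.length_ofFn] at hmarginal
        rw [norm_mul]
        exact mul_le_mul (hG t) hmarginal (norm_nonneg _) ((norm_nonneg _).trans (hG t))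
    _ = g * (Fintype.card (Site p) * B) ^ k := by
        rw [Finset.sum_const, Finset.card_univ, Fintype.card_fun, Fintype.card_fin, nsmul_eq_mul]
        push_cast
        ring

lemma exists_injective_comp_eq {k : ℕ} (i : Fin k → Fin n) :
    ∃ (l : ℕ) (j : Fin l → Fin n) (r : Fin k → Fin l),
      l ≤ k ∧ Function.Injective j ∧ j ∘ r = i := by
  classical
  let j := (Finset.univ.image i).orderEmbOfFin rfl
  have hrange (a : Fin k) : ∃ b, j b = i a := by
    rw [← Set.mem_range, Finset.range_orderEmbOfFin]
    simp
  choose r hr using hrange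
  exact ⟨_, j, r, Finset.card_image_le.trans (by simp), j.injective, funext hr⟩

lemma exists_boundsCorrelations [IsProbabilityMeasure ν] (hν : IsStandardized ν)
    (γ β : Fin p → ℝ) (k : ℕ) : ∃ C, ∀ n, 0 < n → BoundsCorrelations ν γ β n k C := by
  obtain ⟨B, hB₀, hB⟩ := exists_norm_marginal_le hν γ β
  set M : ℝ := Fintype.card (Site p) * B
  have hM : 0 ≤ M := by positivity
  refine ⟨max 1 M ^ k, fun n hn => ⟨by positivity, fun i G g hG => ?_⟩⟩
  obtain ⟨l, j, r, hl, hj, rfl⟩ := exists_injective_comp_eq i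
  have hg : 0 ≤ g := (norm_nonneg _).trans (hG fun _ => 1)
  calc _ ≤ g * M ^ l := norm_sum_comp_mul_gibbsWeight_le (fun L m => hB n L m hn) hj
        (G := fun t => G (t ∘ r)) fun t => hG _
    _ ≤ g * max 1 M ^ k := by
        gcongr
        exact (pow_le_pow_left₀ hM (le_max_right _ _) l).trans
          (pow_le_pow_right₀ (le_max_left _ _) hl)

lemma norm_pairSign (s t : Site p) : ‖pairSign s t‖ = 1 := by
  have hsgn (x : ℤˣ) : ‖(sgn x : ℂ)‖ = 1 := by
    rcases Int.units_eq_one_or x with rfl | rfl <;> simp [sgn]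
  rw [pairSign, norm_mul, hsgn, hsgn, one_mul]

lemma norm_momentRatio_le {s t : Site p} (hlow : 1 / 2 ≤ ‖interaction ν γ n s t‖) (k : ℕ) :
    ‖momentRatio ν γ n k s t‖ ≤ 2 * ∫ x, |x| ^ k ∂ν := by
  have := norm_fourierMoment_le (ν := ν) k (phase γ s t / √n)
  rw [momentRatio, norm_div, div_le_iff₀ (by linarith)]
  nlinarith [norm_nonneg (fourierMoment ν k (phase γ s t / √n))]

lemma abs_phase_le (γ : Fin p → ℝ) (s t : Site p) : |phase γ s t| ≤ 1 + phaseBound γ := by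
  nlinarith [phase_sq_le γ s t, sq_abs (phase γ s t), sq_nonneg (|phase γ s t| - 1)]

lemma norm_edgeTerm_le [IsProbabilityMeasure ν] (hν : IsStandardized ν) {s t : Site p}
    (hlow : 1 / 2 ≤ ‖interaction ν γ n s t‖) :
    ‖edgeTerm ν γ n s t‖ ≤ 2 * (1 + phaseBound γ) / √n := by
  rw [edgeTerm, norm_mul, norm_pairSign, one_mul, momentRatio, norm_div,
    div_le_iff₀ (by linarith)]
  have hγ := phaseBound_nonneg γ
  calc ‖fourierMoment ν 1 (phase γ s t / √n)‖ ≤ |phase γ s t / √n| := by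
        simpa [hν.integral_sq_eq_one] using
          norm_fourierMoment_one_le hν.memLp hν.mean_eq_zero (phase γ s t / √n)
    _ = |phase γ s t| / √n := by rw [abs_div, abs_of_nonneg (Real.sqrt_nonneg _)]
    _ ≤ (1 + phaseBound γ) / √n := by
        gcongr
        exact abs_phase_le γ s t
    _ = 2 * (1 + phaseBound γ) / √n * (1 / 2) := by ring
    _ ≤ _ := by gcongr

lemma norm_edgeTerm_mul_edgeTerm_le [IsProbabilityMeasure ν] (hν : IsStandardized ν)
    (hlow : ∀ s t : Site p, 1 / 2 ≤ ‖interaction ν γ n s t‖) (s t s' t' : Site p) :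
    ‖edgeTerm ν γ n s t * edgeTerm ν γ n s' t'‖ ≤ (2 * (1 + phaseBound γ)) ^ 2 / n := by
  have hle := norm_edgeTerm_le hν (hlow s t)
  rw [norm_mul]
  refine (mul_le_mul hle (norm_edgeTerm_le hν (hlow s' t')) (norm_nonneg _)
    ((norm_nonneg _).trans hle)).trans_eq ?_
  rw [div_mul_div_comm, Real.mul_self_sqrt (Nat.cast_nonneg n), sq]

lemma norm_pairAverage_of_ne_le [IsProbabilityMeasure ν] (hν : IsStandardized ν) {C : ℝ}
    (hC : BoundsCorrelations ν γ β n 4 C) (hlow : ∀ s t : Site p, 1 / 2 ≤ ‖interaction ν γ n s t‖)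
    {ε : Fin 2 → Pairs n} (hε : ε 0 ≠ ε 1) :
    ‖pairAverage ν γ β ε‖ ≤ (2 * (1 + phaseBound γ)) ^ 2 / n * C := by
  have hne (s t : Site p) : interaction ν γ n s t ≠ 0 := norm_pos_iff.1 (by linarith [hlow s t])
  rw [pairAverage_of_injective hne β (injective_of_ne hε)]
  simp only [Fin.prod_univ_two]
  exact hC.norm_sum_le (endpoints ε)
    (fun t => edgeTerm ν γ n (t 0) (t 1) * edgeTerm ν γ n (t 2) (t 3)) _
    fun t => norm_edgeTerm_mul_edgeTerm_le hν hlow _ _ _ _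

lemma norm_twoPairSum_le [IsProbabilityMeasure ν] (hν : IsStandardized ν) {C : ℝ}
    (hC : BoundsCorrelations ν γ β n 4 C) (hlow : ∀ s t : Site p, 1 / 2 ≤ ‖interaction ν γ n s t‖)
    (hn : 4 ≤ n) : ‖twoPairSum ν γ β n‖ ≤ (2 * (1 + phaseBound γ)) ^ 2 / n * C := by
  rw [twoPairSum_eq_sum γ β (Fin.castLE_injective hn)]
  exact hC.norm_sum_le (Fin.castLE hn)
    (fun t => edgeTerm ν γ n (t 0) (t 1) * edgeTerm ν γ n (t 2) (t 3)) _
    fun t => norm_edgeTerm_mul_edgeTerm_le hν hlow _ _ _ _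

lemma norm_pairAverage_const_two_le {C : ℝ} (hvar : ∫ x, x ^ 2 ∂ν = 1)
    (hC : BoundsCorrelations ν γ β n 4 C) (hlow : ∀ s t : Site p, 1 / 2 ≤ ‖interaction ν γ n s t‖)
    (e : Pairs n) : ‖pairAverage ν γ β fun _ : Fin 2 => e‖ ≤ 2 * C := by
  have hne (s t : Site p) : interaction ν γ n s t ≠ 0 := norm_pos_iff.1 (by linarith [hlow s t])
  rw [pairAverage_const hne]
  refine hC.norm_sum_le (endpoints fun _ => e)
    (fun t => pairSign (t 0) (t 1) ^ 2 * momentRatio ν γ n 2 (t 0) (t 1)) _ fun t => ?_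
  rw [norm_mul, norm_pow, norm_pairSign, one_pow, one_mul]
  simpa [hvar] using norm_momentRatio_le (hlow (t 0) (t 1)) 2

lemma norm_pairAverage_sub_twoPairSum_le [IsProbabilityMeasure ν] (hν : IsStandardized ν) {C : ℝ}
    (hC : BoundsCorrelations ν γ β n 4 C) (hlow : ∀ s t : Site p, 1 / 2 ≤ ‖interaction ν γ n s t‖)
    (hn : 4 ≤ n) (ε : Fin 2 → Pairs n) :
    ‖pairAverage ν γ β ε - twoPairSum ν γ β n‖ ≤
      (if Meets (ε 0) (ε 1) then 2 * ((2 * (1 + phaseBound γ)) ^ 2 / n * C) else 0) +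
        if ε 0 = ε 1 then 2 * C else 0 := by
  have hne (s t : Site p) : interaction ν γ n s t ≠ 0 := norm_pos_iff.1 (by linarith [hlow s t])
  have htwo := norm_twoPairSum_le hν hC hlow hn
  by_cases hmeets : Meets (ε 0) (ε 1)
  · refine (norm_sub_le _ _).trans ?_
    rw [if_pos hmeets]
    split_ifs with heq
    · have hconst : ε = fun _ => ε 0 := funext (Fin.forall_fin_two.2 ⟨rfl, heq.symm⟩)
      have hdiag : ‖pairAverage ν γ β ε‖ ≤ 2 * C :=
        hconst ▸ norm_pairAverage_const_two_le hν.integral_sq_eq_one hC hlow (ε 0)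
      linarith [norm_nonneg (twoPairSum ν γ β n)]
    · linarith [norm_pairAverage_of_ne_le hν hC hlow heq]
  · have hdistinct : ε 0 ≠ ε 1 := fun h => hmeets (Or.inl (h ▸ rfl))
    rw [pairAverage_eq_twoPairSum hne β hmeets, sub_self, norm_zero, if_neg hmeets,
      if_neg hdistinct, add_zero]

lemma sum_ite_meets_add_ite_eq_le (n : ℕ) {x y : ℝ} (hx : 0 ≤ x) (hy : 0 ≤ y) :
    ∑ ε : Fin 2 → Pairs n,
        ((if Meets (ε 0) (ε 1) then x else 0) + if ε 0 = ε 1 then y else 0) ≤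
      (n : ℝ) ^ 2 * (4 * n * x + y) := by
  rw [← (finTwoArrowEquiv (Pairs n)).symm.sum_comp, Fintype.sum_prod_type]
  calc _ ≤ ∑ _e : Pairs n, (4 * n * x + y) := Finset.sum_le_sum fun e _ => by
        have hmeets : ((Finset.univ.filter fun e' => Meets e e').card : ℝ) ≤ 4 * n := by
          exact_mod_cast card_filter_meets_le e
        simp only [finTwoArrowEquiv_symm_apply, Matrix.cons_val_zero, Matrix.cons_val_one]
        rw [Finset.sum_add_distrib, ← Finset.sum_filter, Finset.sum_const, nsmul_eq_mul,
          Finset.sum_ite_eq, if_pos (Finset.mem_univ _)]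
        gcongr
    _ = Fintype.card (Pairs n) * (4 * n * x + y) := by
        rw [Finset.sum_const, Finset.card_univ, nsmul_eq_mul]
    _ ≤ _ := by
        gcongr
        exact_mod_cast card_pairs_le n

end Bounds

/-! ## The limits of the moments -/

section Limits

variable {n p : ℕ}

lemma sum_add_mul_mul_sum_sub_mul {ι A : Type*} [Fintype ι] [CommRing A] (x y w : ι → A) :
    (∑ i, (x i + y i) * w i) * ∑ j, (x j - y j) * w j =
      ∑ i, ∑ j, (x i * x j - y i * y j) * (w i * w j) := by
  calc (∑ i, (x i + y i) * w i) * ∑ j, (x j - y j) * w j =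
        (∑ i, x i * w i) * (∑ j, x j * w j) - (∑ i, y i * w i) * ∑ j, y j * w j := by
        simp only [add_mul, sub_mul, Finset.sum_add_distrib, Finset.sum_sub_distrib]
        ring
    _ = _ := by
        simp only [Finset.sum_mul_sum, ← Finset.sum_sub_distrib]
        exact Finset.sum_congr rfl fun i _ => Finset.sum_congr rfl fun j _ => by ring

lemma sum_Phi_mul (γ : Fin p → ℝ) (w : Config p → ℂ) :
    ∑ a, ∑ b, (Phi γ (a * b) : ℂ) * (w a * w b) = ∑ r, (γ r : ℂ) *
      ((∑ u : Config p, ((starProd u.1 r + starProd u.2 r : ℝ) : ℂ) * w u) *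
        ∑ v : Config p, ((starProd v.1 r - starProd v.2 r : ℝ) : ℂ) * w v) := by
  simp only [Complex.ofReal_add, Complex.ofReal_sub, sum_add_mul_mul_sum_sub_mul]
  simp only [Finset.mul_sum]
  rw [← Finset.sum_comm_cycle]
  refine Finset.sum_congr rfl fun a _ => Finset.sum_congr rfl fun b _ => ?_
  simp only [Phi, Prod.fst_mul, Prod.snd_mul, starProd_mul, Complex.ofReal_sum, Finset.sum_mul]
  refine Finset.sum_congr rfl fun r _ => ?_
  push_cast
  ring

/-- The limiting contribution of the histories `s` and `t` of the sites of a pair to the average of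
the corresponding term of the cost function, multiplied by `√n`. -/
def pairLimit (γ β : Fin p → ℝ) (s t : Site p) : ℂ :=
  Complex.I * (Phi γ (s.1 * t.1) : ℝ) * (W γ β s.1 / 2 * (W γ β t.1 / 2))

lemma sum_pairLimit (γ β : Fin p → ℝ) :
    ∑ t : Fin 2 → Site p, pairLimit γ β (t 0) (t 1) = 2 * energyFormula γ β := by
  have henergy : 2 * energyFormula γ β =
      Complex.I * ∑ a, ∑ b, (Phi γ (a * b) : ℂ) * (W γ β a * W γ β b) := by
    rw [sum_Phi_mul, energyFormula]
    simp only [mul_assoc]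
    ring
  rw [henergy, ← (finTwoArrowEquiv (Site p)).symm.sum_comp, Fintype.sum_prod_type]
  simp only [finTwoArrowEquiv_symm_apply, Matrix.cons_val_zero, Matrix.cons_val_one, sum_site,
    sum_units_int, pairLimit, Finset.mul_sum, ← Finset.sum_add_distrib]
  exact Finset.sum_congr rfl fun a _ => Finset.sum_congr rfl fun b _ => by ring

lemma ofReal_sqrt_natCast_mul_self (n : ℕ) : ((√n : ℝ) : ℂ) * (√n : ℝ) = n := by
  rw [← Complex.ofReal_mul, Real.mul_self_sqrt n.cast_nonneg, Complex.ofReal_natCast]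

variable {ν : Measure ℝ} [IsProbabilityMeasure ν]

lemma eventually_half_le_norm_interaction (hν : IsStandardized ν) (γ : Fin p → ℝ) :
    ∀ᶠ n in atTop, ∀ s t : Site p, 1 / 2 ≤ ‖interaction ν γ n s t‖ := by
  refine eventually_all.2 fun s => eventually_all.2 fun t => ?_
  have hlim := (tendsto_interaction hν γ s t).norm
  rw [norm_one] at hlim
  exact hlim.eventually_const_le (by norm_num)

lemma tendsto_edgeTerm (hν : IsStandardized ν) (γ : Fin p → ℝ) (s t : Site p) :
    Tendsto (fun n : ℕ => (√n : ℂ) * edgeTerm ν γ n s t) atTop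
      (𝓝 (Complex.I * (Phi γ (s.1 * t.1) : ℝ))) := by
  have hratio := ((tendsto_sqrt_mul_fourierMoment_one hν.memLp hν.mean_eq_zero
    hν.integral_sq_eq_one (phase γ s t)).div
      (tendsto_interaction hν γ s t) one_ne_zero).const_mul (pairSign s t)
  have hsign : pairSign s t * (Complex.I * (phase γ s t : ℂ) / 1) =
      Complex.I * (Phi γ (s.1 * t.1) : ℝ) := by
    have hs := congrArg Complex.ofReal (sgn_sq s.2)
    have ht := congrArg Complex.ofReal (sgn_sq t.2)
    rw [pairSign, phase]
    push_cast at hs ht ⊢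
    linear_combination (Complex.I * (Phi γ (s.1 * t.1) : ℂ)) * ((sgn t.2 : ℂ) ^ 2 * hs + ht)
  rw [hsign] at hratio
  refine hratio.congr fun n => ?_
  simp only [edgeTerm, momentRatio, Pi.div_apply]
  ring

lemma tendsto_sum_mul_marginal (hν : IsStandardized ν) (γ β : Fin p → ℝ) {k : ℕ}
    {G : ℕ → (Fin k → Site p) → ℂ} {G₀ : (Fin k → Site p) → ℂ}
    (hG : ∀ t, Tendsto (fun n => G n t) atTop (𝓝 (G₀ t))) :
    Tendsto (fun n => ∑ t, G n t * marginal ν γ β n (List.ofFn t) (n - k)) atTop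
      (𝓝 (∑ t, G₀ t * ∏ i, W γ β (t i).1 / 2)) := by
  refine tendsto_finsetSum _ fun t _ => (hG t).mul ?_
  simpa only [List.map_ofFn, List.prod_ofFn, Function.comp_apply] using
    tendsto_marginal hν (isMeanField_W γ β) (List.ofFn t) k

lemma tendsto_onePairSum (hν : IsStandardized ν) (γ β : Fin p → ℝ) :
    Tendsto (fun n : ℕ => (√n : ℂ) * onePairSum ν γ β n) atTop (𝓝 (2 * energyFormula γ β)) := by
  have hlim := tendsto_sum_mul_marginal hν γ β (k := 2) fun t =>
    tendsto_edgeTerm hν γ (t 0) (t 1)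
  rw [← sum_pairLimit]
  simpa only [onePairSum, pairLimit, Finset.mul_sum, mul_assoc, Fin.prod_univ_two] using hlim

lemma tendsto_twoPairSum (hν : IsStandardized ν) (γ β : Fin p → ℝ) :
    Tendsto (fun n : ℕ => (n : ℂ) * twoPairSum ν γ β n) atTop
      (𝓝 ((2 * energyFormula γ β) ^ 2)) := by
  have hsum : ∑ t : Fin 4 → Site p, pairLimit γ β (t 0) (t 1) * pairLimit γ β (t 2) (t 3) =
      (2 * energyFormula γ β) ^ 2 := by
    rw [← sum_pairLimit, sq, Finset.sum_mul_sum, ← (Fin.appendEquiv 2 2).sum_comp,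
      Fintype.sum_prod_type]
    rfl
  have hlim := tendsto_sum_mul_marginal hν γ β (k := 4) fun t =>
    (tendsto_edgeTerm hν γ (t 0) (t 1)).mul (tendsto_edgeTerm hν γ (t 2) (t 3))
  rw [← hsum]
  convert hlim using 2 with n
  · rw [twoPairSum, Finset.mul_sum, ← ofReal_sqrt_natCast_mul_self]
    exact Finset.sum_congr rfl fun t _ => by ring
  · refine Finset.sum_congr rfl fun t _ => ?_
    simp only [pairLimit, Fin.prod_univ_four]
    ring

lemma tendsto_ofReal_card_pairs_div :
    Tendsto (fun n : ℕ => (Fintype.card (Pairs n) : ℂ) / n ^ 2) atTop (𝓝 (1 / 2)) := by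
  simpa [Function.comp_def] using
    (Complex.continuous_ofReal.tendsto _).comp tendsto_card_pairs_div

theorem tendsto_ofReal_integral_energyMoment_one (hν : IsStandardized ν) (γ β : Fin p → ℝ) :
    Tendsto (fun n : ℕ => ((∫ J, energyMoment 1 γ β J ∂(instanceLaw ν n) : ℝ) : ℂ)) atTop
      (𝓝 (energyFormula γ β)) := by
  have hlim := tendsto_ofReal_card_pairs_div.mul (tendsto_onePairSum hν γ β)
  rw [← mul_assoc, one_div_mul_cancel two_ne_zero, one_mul] at hlim
  refine hlim.congr' ?_
  filter_upwards [eventually_half_le_norm_interaction hν γ, eventually_gt_atTop 0] with n hlow hn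
  have hne (s t : Site p) : interaction ν γ n s t ≠ 0 := norm_pos_iff.1 (by linarith [hlow s t])
  have hsqrt : ((√n : ℝ) : ℂ) ≠ 0 :=
    Complex.ofReal_ne_zero.2 (Real.sqrt_pos.2 (Nat.cast_pos.2 hn)).ne'
  rw [integral_energyMoment (hν.memLp_of_le one_le_two)]
  simp only [pairAverage_eq_onePairSum hne, Finset.sum_const, Finset.card_univ, Fintype.card_fun,
    Fintype.card_fin, pow_one, nsmul_eq_mul, Complex.ofReal_mul, Complex.ofReal_natCast]
  rw [← ofReal_sqrt_natCast_mul_self n]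
  field_simp

lemma integral_energyMoment_two_sub (hν : MemLp id 2 ν) (γ β : Fin p → ℝ) (hn : 0 < n) :
    ((∫ J, energyMoment 2 γ β J ∂(instanceLaw ν n) : ℝ) : ℂ) -
        ((Fintype.card (Pairs n) : ℂ) / n ^ 2) ^ 2 * (n * twoPairSum ν γ β n) =
      ((n : ℂ) ^ 3)⁻¹ * ∑ ε : Fin 2 → Pairs n, (pairAverage ν γ β ε - twoPairSum ν γ β n) := by
  have hn' : (n : ℂ) ≠ 0 := Nat.cast_ne_zero.2 hn.ne'
  rw [integral_energyMoment hν]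
  simp only [Finset.sum_sub_distrib, Finset.sum_const, Finset.card_univ, Fintype.card_fun,
    Fintype.card_fin, nsmul_eq_mul, Nat.cast_pow, Complex.ofReal_mul, Complex.ofReal_natCast]
  rw [inv_pow, mul_pow, sq ((√n : ℝ) : ℂ), ofReal_sqrt_natCast_mul_self]
  field_simp

lemma norm_integral_energyMoment_two_sub_le (hν : IsStandardized ν) {γ β : Fin p → ℝ} {C : ℝ}
    (hC : BoundsCorrelations ν γ β n 4 C) (hlow : ∀ s t : Site p, 1 / 2 ≤ ‖interaction ν γ n s t‖)
    (hn : 4 ≤ n) :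
    ‖((∫ J, energyMoment 2 γ β J ∂(instanceLaw ν n) : ℝ) : ℂ) -
        ((Fintype.card (Pairs n) : ℂ) / n ^ 2) ^ 2 * (n * twoPairSum ν γ β n)‖ ≤
      (8 * ((2 * (1 + phaseBound γ)) ^ 2 * C) + 2 * C) / n := by
  have hC₀ := hC.nonneg
  have hsum : ‖∑ ε : Fin 2 → Pairs n, (pairAverage ν γ β ε - twoPairSum ν γ β n)‖ ≤
      (n : ℝ) ^ 2 * (4 * n * (2 * ((2 * (1 + phaseBound γ)) ^ 2 / n * C)) + 2 * C) :=
    (norm_sum_le_of_le _ fun ε _ =>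
      norm_pairAverage_sub_twoPairSum_le hν hC hlow hn ε).trans
        (sum_ite_meets_add_ite_eq_le n (by positivity) (by positivity))
  rw [integral_energyMoment_two_sub hν.memLp γ β (by lia), norm_mul, norm_inv, norm_pow,
    Complex.norm_natCast]
  refine (mul_le_mul_of_nonneg_left hsum (by positivity)).trans_eq ?_
  field_simp
  ring

theorem tendsto_ofReal_integral_energyMoment_two (hν : IsStandardized ν) (γ β : Fin p → ℝ) :
    Tendsto (fun n : ℕ => ((∫ J, energyMoment 2 γ β J ∂(instanceLaw ν n) : ℝ) : ℂ)) atTop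
      (𝓝 (energyFormula γ β ^ 2)) := by
  obtain ⟨C, hC⟩ := exists_boundsCorrelations hν γ β 4
  have hmain := (tendsto_ofReal_card_pairs_div.pow 2).mul (tendsto_twoPairSum hν γ β)
  rw [← mul_pow, ← mul_assoc, one_div_mul_cancel two_ne_zero, one_mul] at hmain
  have herror : Tendsto (fun n : ℕ =>
      ((∫ J, energyMoment 2 γ β J ∂(instanceLaw ν n) : ℝ) : ℂ) -
        ((Fintype.card (Pairs n) : ℂ) / n ^ 2) ^ 2 * (n * twoPairSum ν γ β n)) atTop (𝓝 0) := by
    refine squeeze_zero_norm' ?_ (tendsto_const_div_atTop_nhds_zero_nat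
      (8 * ((2 * (1 + phaseBound γ)) ^ 2 * C) + 2 * C))
    filter_upwards [eventually_half_le_norm_interaction hν γ, eventually_ge_atTop 4]
      with n hlow hn
    exact norm_integral_energyMoment_two_sub_le hν (hC n (by lia)) hlow hn
  simpa only [sub_add_cancel, zero_add] using herror.add hmain

end Limits

/-! ## Concentration -/

section Chebyshev

variable {Ω : ℕ → Type*} [∀ n, MeasurableSpace (Ω n)] {μ : ∀ n, Measure (Ω n)}
  {f g : ∀ n, Ω n → ℝ} {c : ℝ}

lemma tendsto_measureReal_of_tendsto_integral [∀ n, IsFiniteMeasure (μ n)]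
    {S : ∀ n, Set (Ω n)} (hnonneg : ∀ n ω, 0 ≤ f n ω) (hint : ∀ n, Integrable (f n) (μ n))
    (hlim : Tendsto (fun n => ∫ ω, f n ω ∂(μ n)) atTop (𝓝 0)) {δ : ℝ} (hδ : 0 < δ)
    (hS : ∀ n, ∀ ω ∈ S n, δ ≤ f n ω) :
    Tendsto (fun n => (μ n).real (S n)) atTop (𝓝 0) := by
  have hscaled := hlim.div_const δ
  rw [zero_div] at hscaled
  refine squeeze_zero (fun _ => measureReal_nonneg) (fun n => ?_) hscaled
  rw [le_div_iff₀' hδ]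
  calc δ * (μ n).real (S n) ≤ δ * (μ n).real {ω | δ ≤ f n ω} := by
        gcongr
        exacts [measure_ne_top _ _, hS n]
    _ ≤ ∫ ω, f n ω ∂(μ n) :=
        mul_meas_ge_le_integral_of_nonneg (ae_of_all _ (hnonneg n)) (hint n) δ

variable [∀ n, IsProbabilityMeasure (μ n)]

lemma tendsto_integral_sub_two_mul_add_sq (hf : ∀ n, Integrable (f n) (μ n))
    (hg : ∀ n, Integrable (g n) (μ n))
    (hflim : Tendsto (fun n => ∫ ω, f n ω ∂(μ n)) atTop (𝓝 c))
    (hglim : Tendsto (fun n => ∫ ω, g n ω ∂(μ n)) atTop (𝓝 (c ^ 2))) :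
    Tendsto (fun n => ∫ ω, (g n ω - 2 * c * f n ω + c ^ 2) ∂(μ n)) atTop (𝓝 0) := by
  have hlim := (hglim.sub (hflim.const_mul (2 * c))).add_const (c ^ 2)
  rw [show c ^ 2 - 2 * c * c + c ^ 2 = 0 by ring] at hlim
  refine hlim.congr fun n => ?_
  rw [integral_add (f := fun ω => g n ω - 2 * c * f n ω) ((hg n).sub ((hf n).const_mul _))
    (integrable_const _), integral_sub (hg n) ((hf n).const_mul _), integral_const_mul,
    integral_const, probReal_univ, one_smul]

lemma tendsto_measureReal_lt_abs_sub (hf : ∀ n, Integrable (f n) (μ n))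
    (hf₂ : ∀ n, Integrable (fun ω => f n ω ^ 2) (μ n))
    (hlim : Tendsto (fun n => ∫ ω, f n ω ∂(μ n)) atTop (𝓝 c))
    (hlim₂ : Tendsto (fun n => ∫ ω, f n ω ^ 2 ∂(μ n)) atTop (𝓝 (c ^ 2))) {ε : ℝ} (hε : 0 < ε) :
    Tendsto (fun n => (μ n).real {ω | ε < |f n ω - c|}) atTop (𝓝 0) := by
  have hsq (n : ℕ) (ω : Ω n) : f n ω ^ 2 - 2 * c * f n ω + c ^ 2 = |f n ω - c| ^ 2 := by
    rw [sq_abs]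
    ring
  refine tendsto_measureReal_of_tendsto_integral (fun n ω => (hsq n ω).ge.trans' (by positivity))
    (fun n => ((hf₂ n).sub ((hf n).const_mul _)).add (integrable_const _))
    (tendsto_integral_sub_two_mul_add_sq hf hf₂ hlim hlim₂) (pow_pos hε 2) fun n ω hω => ?_
  rw [hsq]
  exact pow_le_pow_left₀ hε.le (le_of_lt hω) 2

end Chebyshev

section Concentration

variable {n p : ℕ} {ν : Measure ℝ}

lemma sum_sq_sub_mul_normSq_qaoaState (γ β : Fin p → ℝ) (J : Couplings n) (c : ℝ) :
    ∑ z, (cost J z / n - c) ^ 2 * ‖qaoaState J γ β z‖ ^ 2 =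
      energyMoment 2 γ β J - 2 * c * energyMoment 1 γ β J + c ^ 2 := by
  calc ∑ z, (cost J z / n - c) ^ 2 * ‖qaoaState J γ β z‖ ^ 2
      = ∑ z, ((cost J z / n) ^ 2 * ‖qaoaState J γ β z‖ ^ 2 -
          2 * c * ((cost J z / n) ^ 1 * ‖qaoaState J γ β z‖ ^ 2) +
          c ^ 2 * ‖qaoaState J γ β z‖ ^ 2) := Finset.sum_congr rfl fun z _ => by ring
    _ = _ := by
      rw [Finset.sum_add_distrib, Finset.sum_sub_distrib, ← Finset.mul_sum, ← Finset.mul_sum,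
        sum_normSq_qaoaState, mul_one, ← energyMoment_eq_sum, ← energyMoment_eq_sum]

lemma sq_energyMoment_one_le (γ β : Fin p → ℝ) (J : Couplings n) :
    energyMoment 1 γ β J ^ 2 ≤ energyMoment 2 γ β J := by
  have hsq := sum_sq_sub_mul_normSq_qaoaState γ β J (energyMoment 1 γ β J)
  have hnonneg : 0 ≤ ∑ z, (cost J z / n - energyMoment 1 γ β J) ^ 2 * ‖qaoaState J γ β z‖ ^ 2 := by
    positivity
  linarith

lemma measureProb_mul_sq_le (γ β : Fin p → ℝ) (J : Couplings n) (c : ℝ) {ε : ℝ} (hε : 0 < ε) :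
    measureProb γ β J {z | ε < |cost J z / n - c|} * ε ^ 2 ≤
      energyMoment 2 γ β J - 2 * c * energyMoment 1 γ β J + c ^ 2 := by
  rw [← sum_sq_sub_mul_normSq_qaoaState, measureProb, Finset.sum_mul]
  refine Finset.sum_le_sum fun z _ => ?_
  by_cases hz : z ∈ {z | ε < |cost J z / n - c|}
  · rw [Set.indicator_of_mem hz, mul_comm, ← sq_abs (cost J z / n - c)]
    gcongr
    exact le_of_lt hz
  · rw [Set.indicator_of_notMem hz, zero_mul]
    positivity

lemma isStandardized_gaussianReal : IsStandardized (gaussianReal 0 1) where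
  memLp := memLp_id_gaussianReal 2
  mean_eq_zero := integral_id_gaussianReal
  integral_sq_eq_one := by
    have hvar := variance_eq_sub (memLp_id_gaussianReal (μ := 0) (v := 1) 2)
    simpa [variance_id_gaussianReal] using hvar.symm

-- The formula does not involve the law of the couplings, so a Gaussian law may be used.
lemma energyFormula_eq_V (γ β : Fin p → ℝ) : energyFormula γ β = (V γ β : ℂ) := by
  have him := (Complex.continuous_im.tendsto _).comp
    (tendsto_ofReal_integral_energyMoment_one isStandardized_gaussianReal γ β)
  have hzero : (energyFormula γ β).im = 0 :=
    tendsto_nhds_unique him (by simp [Function.comp_def])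
  exact Complex.ext rfl hzero

variable [IsProbabilityMeasure ν]

lemma integrable_sq_energyMoment_one (hν : IsStandardized ν) (γ β : Fin p → ℝ) :
    Integrable (fun J : Couplings n => energyMoment 1 γ β J ^ 2) (instanceLaw ν n) := by
  refine (integrable_energyMoment hν.memLp γ β).mono'
    ((integrable_energyMoment (hν.memLp_of_le one_le_two) γ β).aestronglyMeasurable.pow 2)
    (ae_of_all _ fun J => ?_)
  rw [Real.norm_of_nonneg (sq_nonneg _)]
  exact sq_energyMoment_one_le γ β J

lemma tendsto_integral_energyMoment_one (hν : IsStandardized ν) (γ β : Fin p → ℝ) :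
    Tendsto (fun n : ℕ => ∫ J, energyMoment 1 γ β J ∂(instanceLaw ν n)) atTop (𝓝 (V γ β)) := by
  have hlim := tendsto_ofReal_integral_energyMoment_one hν γ β
  rw [energyFormula_eq_V] at hlim
  exact tendsto_ofReal_iff.1 (by exact_mod_cast hlim)

lemma tendsto_integral_energyMoment_two (hν : IsStandardized ν) (γ β : Fin p → ℝ) :
    Tendsto (fun n : ℕ => ∫ J, energyMoment 2 γ β J ∂(instanceLaw ν n)) atTop
      (𝓝 (V γ β ^ 2)) := by
  have hlim := tendsto_ofReal_integral_energyMoment_two hν γ β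
  rw [energyFormula_eq_V] at hlim
  exact tendsto_ofReal_iff.1 (by exact_mod_cast hlim)

lemma tendsto_integral_sq_energyMoment_one (hν : IsStandardized ν) (γ β : Fin p → ℝ) :
    Tendsto (fun n : ℕ => ∫ J, energyMoment 1 γ β J ^ 2 ∂(instanceLaw ν n)) atTop
      (𝓝 (V γ β ^ 2)) :=
  tendsto_of_tendsto_of_tendsto_of_le_of_le ((tendsto_integral_energyMoment_one hν γ β).pow 2)
    (tendsto_integral_energyMoment_two hν γ β)
    (fun _ => even_two.convexOn_pow.map_integral_le (continuous_pow 2).continuousOn isClosed_univ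
      (ae_of_all _ fun _ => Set.mem_univ _)
      (integrable_energyMoment (hν.memLp_of_le one_le_two) γ β)
      (integrable_sq_energyMoment_one hν γ β))
    fun _ => integral_mono (integrable_sq_energyMoment_one hν γ β)
      (integrable_energyMoment hν.memLp γ β) (sq_energyMoment_one_le γ β)

lemma tendsto_integral_measurement_variance (hν : IsStandardized ν) (γ β : Fin p → ℝ) :
    Tendsto (fun n : ℕ => ∫ J, (energyMoment 2 γ β J - energyMoment 1 γ β J ^ 2)
      ∂(instanceLaw ν n)) atTop (𝓝 0) := by
  have hlim := (tendsto_integral_energyMoment_two hν γ β).sub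
    (tendsto_integral_sq_energyMoment_one hν γ β)
  rw [sub_self] at hlim
  exact hlim.congr fun n => (integral_sub (integrable_energyMoment hν.memLp γ β)
    (integrable_sq_energyMoment_one hν γ β)).symm

lemma tendsto_measureReal_lt_measurement_variance (hν : IsStandardized ν) (γ β : Fin p → ℝ)
    {ε : ℝ} (hε : 0 < ε) :
    Tendsto (fun n => (instanceLaw ν n).real
      {J | ε < energyMoment 2 γ β J - energyMoment 1 γ β J ^ 2}) atTop (𝓝 0) :=
  tendsto_measureReal_of_tendsto_integral (fun _ J => sub_nonneg.2 (sq_energyMoment_one_le γ β J))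
    (fun _ => (integrable_energyMoment hν.memLp γ β).sub (integrable_sq_energyMoment_one hν γ β))
    (tendsto_integral_measurement_variance hν γ β) hε fun _ _ hJ => (le_of_lt hJ)

lemma tendsto_measureReal_lt_measureProb (hν : IsStandardized ν) (γ β : Fin p → ℝ) {ε δ : ℝ}
    (hε : 0 < ε) (hδ : 0 < δ) :
    Tendsto (fun n : ℕ => (instanceLaw ν n).real
      {J | δ < measureProb γ β J {z | ε < |cost J z / n - V γ β|}}) atTop (𝓝 0) := by
  have hint (n : ℕ) (k : ℕ) (hk : k ≤ 2) :
      Integrable (fun J : Couplings n => energyMoment k γ β J) (instanceLaw ν n) :=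
    integrable_energyMoment (hν.memLp_of_le hk) γ β
  refine tendsto_measureReal_of_tendsto_integral (fun n J => ?_)
    (fun n => ((hint n 2 le_rfl).sub ((hint n 1 one_le_two).const_mul _)).add (integrable_const _))
    (tendsto_integral_sub_two_mul_add_sq (fun n => hint n 1 one_le_two) (fun n => hint n 2 le_rfl)
      (tendsto_integral_energyMoment_one hν γ β) (tendsto_integral_energyMoment_two hν γ β))
    (mul_pos hδ (pow_pos hε 2)) fun n J hJ => ?_
  · exact (Finset.sum_nonneg fun z _ => by positivity).trans_eq
      (sum_sq_sub_mul_normSq_qaoaState γ β J (V γ β))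
  · exact (mul_le_mul_of_nonneg_right (le_of_lt hJ) (sq_nonneg ε)).trans
      (measureProb_mul_sq_le γ β J (V γ β) hε)

end Concentration

end

end SKQAOA

open SKQAOA in
theorem mainTheorem2 (ν : Measure ℝ) [IsProbabilityMeasure ν] (hν : MemLp id 2 ν)
    (hmean : ∫ x, x ∂ν = 0) (hvar : ∫ x, x ^ 2 ∂ν = 1)
    (p : ℕ) (γ β : Fin p → ℝ) :
    -- the formula for `V_p` is real
    SKQAOA.energyFormula γ β = (SKQAOA.V γ β : ℂ) ∧
    -- the expectations over instances exist
    (∀ n : ℕ,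
      Integrable (fun J => SKQAOA.energyMoment 1 γ β J) (SKQAOA.instanceLaw ν n) ∧
      Integrable (fun J => SKQAOA.energyMoment 1 γ β J ^ 2) (SKQAOA.instanceLaw ν n) ∧
      Integrable (fun J => SKQAOA.energyMoment 2 γ β J) (SKQAOA.instanceLaw ν n)) ∧
    -- the two moments
    Tendsto (fun n : ℕ => ∫ J, SKQAOA.energyMoment 1 γ β J ∂(SKQAOA.instanceLaw ν n))
      atTop (𝓝 (SKQAOA.V γ β)) ∧
    Tendsto (fun n : ℕ => (∫ J, SKQAOA.energyMoment 1 γ β J ∂(SKQAOA.instanceLaw ν n)) ^ 2)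
      atTop (𝓝 (SKQAOA.V γ β ^ 2)) ∧
    Tendsto (fun n : ℕ => ∫ J, SKQAOA.energyMoment 2 γ β J ∂(SKQAOA.instanceLaw ν n))
      atTop (𝓝 (SKQAOA.V γ β ^ 2)) ∧
    -- concentration over instances
    Tendsto (fun n : ℕ => (∫ J, SKQAOA.energyMoment 1 γ β J ^ 2 ∂(SKQAOA.instanceLaw ν n)) -
        (∫ J, SKQAOA.energyMoment 1 γ β J ∂(SKQAOA.instanceLaw ν n)) ^ 2)
      atTop (𝓝 0) ∧
    (∀ ε : ℝ, 0 < ε →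
      Tendsto (fun n : ℕ => (SKQAOA.instanceLaw ν n).real
        {J | ε < |SKQAOA.energyMoment 1 γ β J - SKQAOA.V γ β|}) atTop (𝓝 0)) ∧
    -- the measurement variance is nonnegative and vanishes in mean and in probability
    (∀ (n : ℕ) (J : SKQAOA.Couplings n),
      0 ≤ SKQAOA.energyMoment 2 γ β J - SKQAOA.energyMoment 1 γ β J ^ 2) ∧
    Tendsto (fun n : ℕ => ∫ J, (SKQAOA.energyMoment 2 γ β J - SKQAOA.energyMoment 1 γ β J ^ 2)
        ∂(SKQAOA.instanceLaw ν n)) atTop (𝓝 0) ∧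
    (∀ ε : ℝ, 0 < ε →
      Tendsto (fun n : ℕ => (SKQAOA.instanceLaw ν n).real
        {J | ε < SKQAOA.energyMoment 2 γ β J - SKQAOA.energyMoment 1 γ β J ^ 2})
        atTop (𝓝 0)) ∧
    -- for typical instances, a measured string has energy close to `V_p`
    (∀ ε δ : ℝ, 0 < ε → 0 < δ →
      Tendsto (fun n : ℕ => (SKQAOA.instanceLaw ν n).real
        {J | δ < SKQAOA.measureProb γ β J
          {z | ε < |SKQAOA.cost J z / n - SKQAOA.V γ β|}}) atTop (𝓝 0)) := by
  have hstd : IsStandardized ν := ⟨hν, hmean, hvar⟩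
  have hint (n : ℕ) : Integrable (fun J => energyMoment 1 γ β J) (instanceLaw ν n) :=
    integrable_energyMoment (hstd.memLp_of_le one_le_two) γ β
  have hint_sq (n : ℕ) : Integrable (fun J => energyMoment 1 γ β J ^ 2) (instanceLaw ν n) :=
    integrable_sq_energyMoment_one hstd γ β
  have hlim := tendsto_integral_energyMoment_one hstd γ β
  have hlim_sq := tendsto_integral_sq_energyMoment_one hstd γ β
  refine ⟨energyFormula_eq_V γ β,
    fun n => ⟨hint n, hint_sq n, integrable_energyMoment hν γ β⟩,
    hlim, hlim.pow 2, tendsto_integral_energyMoment_two hstd γ β, ?_,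
    fun ε hε => tendsto_measureReal_lt_abs_sub hint hint_sq hlim hlim_sq hε,
    fun n J => sub_nonneg.2 (sq_energyMoment_one_le γ β J),
    tendsto_integral_measurement_variance hstd γ β,
    fun ε hε => tendsto_measureReal_lt_measurement_variance hstd γ β hε,
    fun ε δ hε hδ => tendsto_measureReal_lt_measureProb hstd γ β hε hδ⟩
  simpa only [sub_self] using hlim_sq.sub (hlim.pow 2)
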